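/- Let $\Sigma$ be a finite alphabet. A \emph{Parikh automaton} of dimension $d\ge 1$ over $\Sigma$ consists of a finite set of states $Q$, an initial state $q_I\in Q$, a set of final states $F\subseteq Q$, a semilinear set $C\subseteq\mathbb N^d$ (a finite union of sets $\{c+\lambda_1p_1+\dots+\lambda_rp_r : \lambda_i\in\mathbb N\}$ with $c,p_i\in\mathbb N^d$) and a finite set of transitions $\Delta\subseteq Q\times(\Sigma\times\mathbb N^d)\times Q$. A run $q_0\xrightarrow{a_1,v_1}q_1\cdots\xrightarrow{a_n,v_n}q_n$ ($n\ge 0$), each of whose steps is in $\Delta$, is an accepting run of the word $a_1\cdots a_n$ if $q_0=q_I$, $q_n\in F$ and $v_1+\dots+v_n\in C$. The automaton is \emph{weakly-unambiguous} if every word has at most one accepting run. A (non-deterministic, two-way) \emph{$k$-counter machine} over $\Sigma$, $k\ge 0$, has a finite set of states, an initial state, a set of final states, a read-only tape that contains the input word between a left and a right end-marker, and $k$ counters with values in $\mathbb N$. It starts in the initial state with its head on the left end-marker and all counters zero. In one step, depending on the state, the symbol under the head and the set of counters that are zero, it changes its state, moves its head by one cell to the left or right or leaves it in place, and adds $-1$,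 $0$ or $1$ to each counter; a step that would move the head off the tape or make a counter negative is not possible. A computation is a finite sequence of successive configurations (state, head position, counter values) that begins with the initial one; it is accepting if it ends in a configuration with a final state in which no step is possible. The machine is \emph{reversal-bounded} if there are $m,n\in\mathbb N$ such that on every input, in every computation, the head changes its direction between left and right at most $m$ times and each counter alternates between incrementing and decrementing at most $n$ times. It is \emph{unambiguous} if every word has at most one accepting computation. Each model accepts the language of all words that have an accepting run, respectively an accepting computation. \textbf{Proposition.} A language $L\subseteq\Sigma^*$ is accepted by an unambiguous two-way reversal-bounded counter machine if and only if it is accepted by a weakly-unambiguous Parikh automaton. -/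

import Mathlib

/-! ## Parikh automata -/

/-- A Parikh automaton of dimension `d` over the alphabet `α` with set of states `Q`. -/
structure ParikhAutomaton (α Q : Type*) (d : ℕ) where
  /-- the initial state -/
  start : Q
  /-- the final states -/
  final : Set Q
  /-- the constraint -/
  constraint : Set (Fin d → ℕ)
  /-- the constraint is a finite union of linear sets -/
  semilinear : IsSemilinearSet constraint
  /-- the transitions `(p, (a, v), q)` -/
  trans : Set (Q × (α × (Fin d → ℕ)) × Q)
  /-- there are finitely many transitions -/
  finite_trans : trans.Finite

namespace ParikhAutomaton

variable {α Q : Type*} {d : ℕ} (A : ParikhAutomaton α Q d)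

/-- `A.IsRun p π q`: the sequence `π = [((a₁, v₁), q₁), …, ((aₙ, vₙ), qₙ)]` is such that
`p -(a₁, v₁)→ q₁ -(a₂, v₂)→ q₂ ⋯ -(aₙ, vₙ)→ qₙ` is a run of `A` from `p` to `q = qₙ`
(with `q = p` if `n = 0`). -/
inductive IsRun : Q → List ((α × (Fin d → ℕ)) × Q) → Q → Prop
  | nil (p : Q) : IsRun p [] p
  | cons {p q r : Q} {x : α × (Fin d → ℕ)} {π : List ((α × (Fin d → ℕ)) × Q)} :
      (p, x, q) ∈ A.trans → IsRun q π r → IsRun p ((x, q) :: π) r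

/-- `π` is an accepting run labelled by the word `w`. -/
def IsAcceptingRun (w : List α) (π : List ((α × (Fin d → ℕ)) × Q)) : Prop :=
  (∃ q ∈ A.final, A.IsRun A.start π q) ∧
    π.map (fun s => s.1.1) = w ∧
    (π.map (fun s => s.1.2)).sum ∈ A.constraint

/-- The language accepted by a Parikh automaton. -/
def accepts : Language α := {w | ∃ π, A.IsAcceptingRun w π}

/-- Every word has at most one accepting run. -/
def WeaklyUnambiguous : Prop :=
  ∀ w π π', A.IsAcceptingRun w π → A.IsAcceptingRun w π' → π = π'

end ParikhAutomaton

/-- `L` is accepted by a weakly-unambiguous Parikh automaton (of some dimension `d ≥ 1`). -/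
def IsWeaklyUnambiguousPALanguage {α : Type*} (L : Language α) : Prop :=
  ∃ (Q : Type) (_ : Finite Q) (d : ℕ) (_ : 1 ≤ d) (A : ParikhAutomaton α Q d),
    A.WeaklyUnambiguous ∧ A.accepts = L

/-! ## Two-way counter machines -/

/-- The symbols on the read-only tape: the letters of the input and two end-markers. -/
inductive TapeSymbol (α : Type*)
  | leftEnd : TapeSymbol α
  | letter (a : α) : TapeSymbol α
  | rightEnd : TapeSymbol α

/-- The tape of the input word `w = a₁ ⋯ aₙ` has the left end-marker in cell `0`, the letter `aᵢ`
in cell `i` for `1 ≤ i ≤ n`, and the right end-marker in cell `n + 1`. -/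
def tapeSymbolAt {α : Type*} (w : List α) : ℕ → TapeSymbol α
  | 0 => TapeSymbol.leftEnd
  | i + 1 => match w[i]? with
    | some a => TapeSymbol.letter a
    | none => TapeSymbol.rightEnd

/-- A transition of a machine with `k` counters: in state `source`, reading `symbol`, and provided
that the counters which are zero are exactly those `i` with `isZero i = true`, the machine may enter
the state `target`, move its head by `move` (`-1`: left, `0`: stay, `1`: right) and add `update i`
to the counter `i`. -/
structure CounterTransition (α Q : Type*) (k : ℕ) where
  source : Q
  symbol : TapeSymbol α
  isZero : Fin k → Bool
  target : Q
  move : SignType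
  update : Fin k → SignType

/-- A (non-deterministic, two-way) `k`-counter machine. -/
structure CounterMachine (α Q : Type*) (k : ℕ) where
  /-- the initial state -/
  start : Q
  /-- the final states -/
  final : Set Q
  /-- the transitions -/
  trans : Set (CounterTransition α Q k)

/-- A configuration: the state, the position of the head and the values of the counters. -/
structure CounterConfig (Q : Type*) (k : ℕ) where
  state : Q
  head : ℕ
  counter : Fin k → ℕ

/-- The number of alternations between increasing and decreasing in a sequence of natural numbers:
the signs of the successive differences are listed, the zeros are removed and repetitions of the
same sign in a row are merged; what is left is one sign per direction taken in turn. -/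
def numReversals (l : List ℕ) : ℕ :=
  ((((List.zipWith (fun x y : ℕ => if x < y then (1 : SignType) else if y < x then -1 else 0)
    l l.tail).filter (fun s => s ≠ 0)).destutter (fun s t => s ≠ t)).length) - 1

namespace CounterMachine

variable {α Q : Type*} {k : ℕ} (M : CounterMachine α Q k)

/-- The initial configuration: the head is on the left end-marker and all counters are zero. -/
def initial : CounterConfig Q k := ⟨M.start, 0, fun _ => 0⟩

/-- `M.Step w c c'`: on the input word `w` the machine can go from `c` to `c'` in one step. The head
cannot leave the tape, and a counter that is zero cannot be decremented. -/
def Step (w : List α) (c c' : CounterConfig Q k) : Prop :=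
  ∃ t ∈ M.trans,
    t.source = c.state ∧
    t.symbol = tapeSymbolAt w c.head ∧
    (∀ i, t.isZero i = true ↔ c.counter i = 0) ∧
    c'.state = t.target ∧
    (c'.head : ℤ) = (c.head : ℤ) + (t.move : ℤ) ∧
    c'.head ≤ w.length + 1 ∧
    (∀ i, (c'.counter i : ℤ) = (c.counter i : ℤ) + (t.update i : ℤ))

/-- A computation on `w`, as the non-empty finite sequence of its configurations. (Two consecutive
configurations determine the transition used.) -/
def IsComputation (w : List α) (π : List (CounterConfig Q k)) : Prop :=
  π.head? = some M.initial ∧ π.IsChain (M.Step w)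

/-- A computation on `w` is accepting if it halts in a final state. -/
def IsAcceptingComputation (w : List α) (π : List (CounterConfig Q k)) : Prop :=
  M.IsComputation w π ∧
    ∃ c, π.getLast? = some c ∧ c.state ∈ M.final ∧ ∀ c', ¬ M.Step w c c'

/-- The language accepted by a counter machine. -/
def accepts : Language α := {w | ∃ π, M.IsAcceptingComputation w π}

/-- Every word has at most one accepting computation. -/
def Unambiguous : Prop :=
  ∀ w π π', M.IsAcceptingComputation w π → M.IsAcceptingComputation w π' → π = π'

/-- On every input, in every computation, the head changes direction at most `m` times and each
counter alternates between incrementing and decrementing at most `n` times. -/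
def IsReversalBounded (m n : ℕ) : Prop :=
  ∀ w π, M.IsComputation w π →
    numReversals (π.map (fun c => c.head)) ≤ m ∧
    ∀ i, numReversals (π.map (fun c => c.counter i)) ≤ n

end CounterMachine

/-- `L` is accepted by an unambiguous (two-way) reversal-bounded counter machine. -/
def IsUnambiguousRBCMLanguage {α : Type*} (L : Language α) : Prop :=
  ∃ (Q : Type) (_ : Finite Q) (k : ℕ) (M : CounterMachine α Q k),
    (∃ m n, M.IsReversalBounded m n) ∧ M.Unambiguous ∧ M.accepts = L

/-! From machines to Parikh automata. Let the mode of a configuration be its set of zero counters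
together with the last directions of the counters and of the head. Reversal-boundedness bounds the
number of mode changes (`CounterMachine.modeChanges_le`), so a computation splits into boundedly
many phases of constant mode. A device without counters (`CounterMachine.phaseSystem`) guesses the
modes. Within a phase every counter is monotone, hence the guesses are right as soon as they are
right when each phase begins and ends (`PhaseState.valid_zero_iff`), which is a semilinear condition
on the numbers of visits of the states.

It remains to make two-way runs one-way without losing unambiguity. A run is cut into blocks, the
maximal parts with constant cell and phase. In one phase the head goes one way only, so each cell
has at most one block per phase, and the finite sets of blocks at the cells (the columns) already
determine the order of the blocks. Columns are characterised by conditions on neighbouring cells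
(`TwoWaySystem.isColumns_iff`), which a finite automaton checks from left to right. A block may be
arbitrarily long, but its possible visit vectors form a semilinear set (`PathSum.isSemilinearSet`).
The Parikh automaton therefore counts blocks of each type, and its constraint says that visits of
these blocks can be chosen with a good sum. Every accepting run of it stems from a run of the
device, and that run determines the columns; so uniqueness is inherited.

From Parikh automata to machines. Guessing the coefficients of a linear set would create ambiguity.
Instead, membership in a semilinear set is decided by finitely many integer inequalities and by
residues (`IsSemilinearSet.isTestable`). A one-way machine keeps the residues in its state and the
positive and negative part of each inequality in a pair of counters; at the right end-marker it
decreases the members of each pair together until one of them is zero. Only the choice of the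
transitions of the Parikh automaton is non-deterministic, so accepting computations correspond to
accepting runs. -/

/-! ## Semilinear sets are decided by linear inequalities and congruences -/

/-- A set of vectors is testable if membership depends only on the truth values of finitely many
affine inequalities with integer coefficients and on the residues modulo some `m > 0`. -/
def IsTestable {ι : Type*} [Fintype ι] (C : Set (ι → ℕ)) : Prop :=
  ∃ m : ℕ, 0 < m ∧ ∃ F : Finset ((ι → ℤ) × ℤ), ∀ v v' : ι → ℕ,
    (∀ t ∈ F, 0 ≤ t.2 + ∑ i, t.1 i * v i ↔ 0 ≤ t.2 + ∑ i, t.1 i * v' i) →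
    (∀ i, v i ≡ v' i [MOD m]) → v ∈ C → v' ∈ C

theorem IsTestable.empty {ι : Type*} [Fintype ι] : IsTestable (∅ : Set (ι → ℕ)) :=
  ⟨1, one_pos, ∅, fun _ _ _ _ h => h⟩

theorem IsTestable.union {ι : Type*} [Fintype ι] {C C' : Set (ι → ℕ)} (h : IsTestable C)
    (h' : IsTestable C') : IsTestable (C ∪ C') := by
  classical
  obtain ⟨m, hm, F, hF⟩ := h
  obtain ⟨m', hm', F', hF'⟩ := h'
  refine ⟨m * m', Nat.mul_pos hm hm', F ∪ F', fun v v' ht hr => ?_⟩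
  rintro (hv | hv)
  · exact Or.inl (hF v v' (fun t h => ht t (Finset.mem_union_left _ h))
      (fun i => (hr i).of_mul_right _) hv)
  · exact Or.inr (hF' v v' (fun t h => ht t (Finset.mem_union_right _ h))
      (fun i => (hr i).of_mul_left _) hv)

/-- Clearing denominators by a positive factor keeps the sign, so sign conditions on a rational
functional become integer inequalities. -/
theorem exists_int_coeff {ι : Type*} [Fintype ι] (g : (ι → ℚ) →ₗ[ℚ] ℚ) :
    ∃ (D : ℕ) (a : ι → ℤ), 0 < D ∧
      ∀ v : ι → ℕ, (D : ℚ) * g (fun i => (v i : ℚ)) = ∑ i, (a i : ℚ) * v i := by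
  classical
  have hD : (0 : ℕ) < ∏ i, (g (Pi.single i 1)).den := Finset.prod_pos fun i _ => Rat.den_pos _
  have key : ∀ i, ∃ z : ℤ, ((∏ i, (g (Pi.single i 1)).den : ℕ) : ℚ) * g (Pi.single i 1) = z := by
    intro i
    obtain ⟨k, hk⟩ := Finset.dvd_prod_of_mem (fun i => (g (Pi.single i 1)).den) (Finset.mem_univ i)
    refine ⟨k * (g (Pi.single i 1)).num, ?_⟩
    rw [hk]
    push_cast
    rw [mul_comm ((g (Pi.single i 1)).den : ℚ), mul_assoc, Rat.den_mul_eq_num]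
  choose a ha using key
  refine ⟨_, a, hD, fun v => ?_⟩
  have hv : (fun i => (v i : ℚ)) = ∑ i, (v i : ℚ) • (Pi.single i 1 : ι → ℚ) := by
    ext j
    simp [Finset.sum_apply, Pi.single_apply]
  rw [hv, map_sum, Finset.mul_sum]
  refine Finset.sum_congr rfl fun i _ => ?_
  rw [map_smul, smul_eq_mul, ← ha i]
  ring

/-- A rational relation may be taken with integer coefficients; moving its negative terms to the
other side gives an equality of two combinations over `ℕ`, where independence is assumed. -/
theorem linearIndependent_natCast {ι : Type*} {t : Finset (ι → ℕ)}
    (ht : LinearIndepOn ℕ id (t : Set (ι → ℕ))) :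
    LinearIndependent ℚ (fun p : t => fun i => ((p.1 i : ℕ) : ℚ)) := by
  rw [← LinearIndependent.iff_fractionRing ℤ ℚ, Fintype.linearIndependent_iff]
  intro f hf p
  have ht' : LinearIndependent ℕ (fun p : t => p.1) := ht
  rw [Fintype.linearIndependent_iffₛ] at ht'
  have := ht' (fun p => (f p).toNat) (fun p => (-f p).toNat) ?_ p
  · have h1 := (f p).toNat_sub_toNat_neg
    omega
  · ext i
    have h := congrFun hf i
    simp only [Finset.sum_apply, Pi.smul_apply, zsmul_eq_mul, Pi.zero_apply, smul_eq_mul] at h ⊢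
    have h2 : ((∑ p : t, f p * (p.1 i : ℤ) : ℤ) : ℚ) = 0 := by push_cast; exact h
    have h3 : (∑ p : t, f p * (p.1 i : ℤ) : ℤ) = 0 := by exact_mod_cast h2
    zify
    rw [← sub_eq_zero, ← Finset.sum_sub_distrib, ← h3]
    refine Finset.sum_congr rfl fun p _ => ?_
    rw [← sub_mul]
    congr 1
    exact (f p).toNat_sub_toNat_neg

/-- Since the periods are independent over `ℚ`, the map `P` from coefficients to vectors has a left
inverse `G`. So `v` lies in the set iff `v - c = P (G (v - c))` and the coordinates of `G (v - c)`
are natural numbers. The equations and the signs are inequalities (an equation is two opposite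
ones); integrality is inherited from `v` to `v'`, because the modulus is a multiple of every
denominator `D s`. -/
theorem IsProperLinearSet.isTestable {ι : Type*} [Fintype ι] {C : Set (ι → ℕ)}
    (hC : IsProperLinearSet C) : IsTestable C := by
  classical
  obtain ⟨c, t, ht, rfl⟩ := isProperLinearSet_iff.1 hC
  let cast : (ι → ℕ) →+ (ι → ℚ) := (Nat.castAddMonoidHom ℚ).compLeft ι
  have hcast : ∀ v i, cast v i = (v i : ℚ) := fun _ _ => rfl
  let P : (t → ℚ) →ₗ[ℚ] (ι → ℚ) := Fintype.linearCombination ℚ (fun p : t => cast p.1)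
  have hP : LinearMap.ker P = ⊥ := LinearMap.ker_eq_bot.2
    (linearIndependent_natCast ht).fintypeLinearCombination_injective
  obtain ⟨G, hG⟩ := LinearMap.exists_leftInverse_of_injective P hP
  have hGP : ∀ y, G (P y) = y := fun y => LinearMap.congr_fun hG y
  let g : t ⊕ ι → ((ι → ℚ) →ₗ[ℚ] ℚ) := Sum.elim (fun p => LinearMap.proj p ∘ₗ G)
    (fun j => LinearMap.proj j ∘ₗ (LinearMap.id - P ∘ₗ G))
  choose D a hD ha using fun s => exists_int_coeff (g s)
  replace ha : ∀ s (v : ι → ℕ), (D s : ℚ) * g s (cast v) = ∑ i, (a s i : ℚ) * v i := ha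
  let F : Finset ((ι → ℤ) × ℤ) := Finset.univ.biUnion fun s =>
    {(a s, -∑ i, a s i * c i), (-a s, ∑ i, a s i * c i)}
  refine ⟨∏ s, D s, Finset.prod_pos fun s _ => hD s, F, fun v v' hF hm hv => ?_⟩
  have hsum : ∀ s (x : ι → ℕ), (D s : ℚ) * g s (cast x - cast c) =
      ((-∑ i, a s i * c i + ∑ i, a s i * x i : ℤ) : ℚ) := by
    intro s x
    rw [map_sub, mul_sub, ha, ha]
    push_cast
    ring
  have hDq : ∀ s, (0 : ℚ) < D s := fun s => by exact_mod_cast hD s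
  have hpos : ∀ s, 0 ≤ g s (cast v - cast c) → 0 ≤ g s (cast v' - cast c) := by
    intro s h
    have h1 := hF (a s, -∑ i, a s i * c i) (Finset.mem_biUnion.2 ⟨s, Finset.mem_univ _, by simp⟩)
    simp only at h1
    have h2 : (0 : ℚ) ≤ D s * g s (cast v - cast c) := mul_nonneg (hDq s).le h
    rw [hsum, Int.cast_nonneg_iff, h1, ← Int.cast_nonneg_iff (R := ℚ), ← hsum] at h2
    exact nonneg_of_mul_nonneg_right h2 (hDq s)
  have hneg : ∀ s, g s (cast v - cast c) ≤ 0 → g s (cast v' - cast c) ≤ 0 := by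
    intro s h
    have h1 := hF (-a s, ∑ i, a s i * c i) (Finset.mem_biUnion.2 ⟨s, Finset.mem_univ _, by simp⟩)
    simp only [Pi.neg_apply, neg_mul, Finset.sum_neg_distrib] at h1
    have h2 : (D s : ℚ) * g s (cast v - cast c) ≤ 0 := mul_nonpos_of_nonneg_of_nonpos (hDq s).le h
    have h3 : (D s : ℚ) * g s (cast v' - cast c) ≤ 0 := by
      rw [hsum, Int.cast_nonpos] at h2 ⊢
      have := h1.1 (by linarith)
      linarith
    exact nonpos_of_mul_nonpos_right h3 (hDq s)
  have hint : ∀ s, ∃ z : ℤ, g s (cast v') - g s (cast v) = z := by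
    intro s
    have hk : ∀ i, ∃ k : ℤ, (v' i : ℤ) - v i = D s * k := by
      intro i
      have h1 := (Nat.modEq_iff_dvd.1 (hm i))
      exact (Int.natCast_dvd_natCast.2 (Finset.dvd_prod_of_mem D (Finset.mem_univ s))).trans h1
    choose k hk using hk
    refine ⟨∑ i, a s i * k i, mul_left_cancel₀ (hDq s).ne' ?_⟩
    rw [mul_sub, ha, ha, ← Finset.sum_sub_distrib]
    push_cast
    rw [Finset.mul_sum]
    refine Finset.sum_congr rfl fun i _ => ?_
    have h2 : ((v' i : ℚ) - v i) = D s * k i := by exact_mod_cast hk i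
    rw [← mul_sub, h2]
    ring
  obtain ⟨y, hy, hvy⟩ := hv
  obtain ⟨n, rfl⟩ : ∃ n : t → ℕ, y = ∑ p : t, n p • p.1 := by
    obtain ⟨n, hn⟩ := AddSubmonoid.mem_closure_finset'.1 hy
    exact ⟨n, hn⟩
  have hv : cast v - cast c = P (fun p => (n p : ℚ)) := by
    rw [← hvy]
    simp only [vadd_eq_add, map_add, map_sum, map_nsmul, add_sub_cancel_left, P,
      Fintype.linearCombination_apply]
    refine Finset.sum_congr rfl fun p _ => ?_
    rw [Nat.cast_smul_eq_nsmul]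
  have hN : ∀ p : t, ∃ N : ℕ, G (cast v' - cast c) p = N := by
    intro p
    have h0 := hpos (Sum.inl p) (by simp [g, hv, hGP])
    obtain ⟨z, hz⟩ := hint (Sum.inl p)
    have h1 : g (Sum.inl p) (cast v' - cast c) = (z + n p : ℤ) := by
      have h2 : g (Sum.inl p) (cast v - cast c) = n p := by
        simp [g, hv, hGP]
      rw [map_sub] at h2 ⊢
      push_cast
      rw [← hz, ← h2]
      ring
    rw [h1] at h0
    have h3 : 0 ≤ z + n p := by exact_mod_cast h0
    refine ⟨(z + n p).toNat, ?_⟩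
    have h4 : G (cast v' - cast c) p = (z + n p : ℤ) := h1
    rw [h4]
    exact_mod_cast (Int.toNat_of_nonneg h3).symm
  choose N hN using hN
  have hE : cast v' - cast c = P (G (cast v' - cast c)) := by
    ext j
    have h0 : g (Sum.inr j) (cast v - cast c) = 0 := by
      simp [g, hv, hGP]
    have h1 := le_antisymm (hneg (Sum.inr j) h0.le) (hpos (Sum.inr j) h0.ge)
    have h2 : (cast v' - cast c) j - P (G (cast v' - cast c)) j = 0 := h1
    linarith
  refine ⟨∑ p : t, N p • p.1, sum_mem fun p _ => nsmul_mem (AddSubmonoid.mem_closure_of_mem p.2) _,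
    ?_⟩
  have hinj : Function.Injective cast := fun x y h => by
    ext i
    have := congrFun h i
    simpa [hcast] using this
  apply hinj
  simp only [vadd_eq_add, map_add]
  have hPN : P (fun p => (N p : ℚ)) = cast (∑ p : t, N p • p.1) := by
    simp only [map_sum, map_nsmul, P, Fintype.linearCombination_apply]
    exact Finset.sum_congr rfl fun p _ => Nat.cast_smul_eq_nsmul ..
  rw [← hPN, ← funext hN, ← hE, add_sub_cancel]

theorem IsSemilinearSet.isTestable {ι : Type*} [Fintype ι] {C : Set (ι → ℕ)}
    (hC : IsSemilinearSet C) : IsTestable C := by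
  obtain ⟨S, hS, hS', rfl⟩ := hC.isProperSemilinearSet
  clear hC
  induction S, hS using Set.Finite.induction_on with
  | empty => simpa using IsTestable.empty
  | @insert s S _ _ ih =>
    rw [Set.sUnion_insert]
    exact (hS' s (Set.mem_insert _ _)).isTestable.union
      (ih fun t ht => hS' t (Set.mem_insert_of_mem _ ht))

/-! ## Weights of paths -/

open scoped Pointwise

/-- `PathSum E p q w`: in the graph with the weighted edges `E` there is a path from `p` to `q` of
total weight `w`. -/
inductive PathSum {V M : Type*} [AddCommMonoid M] (E : Set (V × M × V)) : V → V → M → Prop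
  | nil (p : V) : PathSum E p p 0
  | cons {p q r : V} {x w : M} : (p, x, q) ∈ E → PathSum E q r w → PathSum E p r (x + w)

namespace PathSum

variable {V M : Type*} [AddCommMonoid M] {E E' : Set (V × M × V)} {p q r : V} {w w' : M}

theorem mono (h : E ⊆ E') (hp : PathSum E p q w) : PathSum E' p q w := by
  induction hp with
  | nil p => exact .nil p
  | cons he _ ih => exact .cons (h he) ih

theorem trans (h : PathSum E p q w) (h' : PathSum E q r w') : PathSum E p r (w + w') := by
  induction h with
  | nil p => simpa using h'
  | cons he _ ih => rw [add_assoc]; exact .cons he (ih h')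

theorem of_mem_closure {X : Set M} (hX : ∀ x ∈ X, PathSum E p p x)
    (hw : w ∈ AddSubmonoid.closure X) : PathSum E p p w := by
  induction hw using AddSubmonoid.closure_induction with
  | mem x hx => exact hX x hx
  | zero => exact .nil p
  | add x y _ _ hx hy => exact hx.trans hy

/-- A path through the new edge goes to `a`, crosses the edge, repeats loops from `b` to `a` and
across the edge, and ends with a path from `b`. As the weights commute, the loops contribute an
element of the submonoid generated by their weights. -/
theorem setOf_insert (a b : V) (x : M) (p q : V) :
    {w | PathSum (insert (a, x, b) E) p q w} = {w | PathSum E p q w} ∪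
      ({w | PathSum E p a w} + ({x} + ((AddSubmonoid.closure ({w | PathSum E b a w} + {x}) : Set M) +
        {w | PathSum E b q w}))) := by
  ext w
  constructor
  · intro h
    induction h with
    | nil p => exact Or.inl (.nil p)
    | @cons p q r y w he h ih =>
      rcases he with he | he
      · obtain ⟨rfl, hy, rfl⟩ : p = a ∧ y = x ∧ q = b := by simpa using he
        subst hy
        right
        rcases ih with ih | ⟨w₁, h₁, _, ⟨_, rfl, _, ⟨c, hc, w₂, h₂, rfl⟩, rfl⟩, rfl⟩
        · exact ⟨0, .nil p, _, ⟨_, rfl, _, ⟨0, zero_mem _, w, ih, rfl⟩, rfl⟩, by simp⟩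
        · refine ⟨0, .nil p, _, ⟨_, rfl, _, ⟨(w₁ + _) + c, add_mem
            (AddSubmonoid.subset_closure ⟨w₁, h₁, _, rfl, rfl⟩) hc, w₂, h₂, rfl⟩, rfl⟩, ?_⟩
          simp only
          abel
      · rcases ih with ih | ⟨w₁, h₁, _, ⟨_, rfl, _, ⟨c, hc, w₂, h₂, rfl⟩, rfl⟩, rfl⟩
        · exact Or.inl (.cons he ih)
        · exact Or.inr ⟨y + w₁, .cons he h₁, _, ⟨_, rfl, _, ⟨c, hc, w₂, h₂, rfl⟩, rfl⟩,
            by simp only; abel⟩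
  · have hE : E ⊆ insert (a, x, b) E := Set.subset_insert _ _
    rintro (h | ⟨w₁, h₁, _, ⟨_, rfl, _, ⟨c, hc, w₂, h₂, rfl⟩, rfl⟩, rfl⟩)
    · exact h.mono hE
    · refine (h₁.mono hE).trans (.cons (Set.mem_insert _ _) ((of_mem_closure ?_ hc).trans
        (h₂.mono hE)))
      rintro _ ⟨u, hu, _, rfl, rfl⟩
      simpa using (mono hE hu).trans (.cons (Set.mem_insert _ _) (.nil b))

/-- The weights of the paths between two vertices of a finite graph form a semilinear set. -/
theorem isSemilinearSet (hE : E.Finite) (p q : V) : IsSemilinearSet {w | PathSum E p q w} := by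
  induction E, hE using Set.Finite.induction_on generalizing p q with
  | empty =>
    apply IsSemilinearSet.of_finite
    apply (Set.finite_singleton 0).subset
    intro w hw
    cases hw with
    | nil => rfl
    | cons h => exact h.elim
  | @insert e E _ _ ih =>
    obtain ⟨a, x, b⟩ := e
    rw [setOf_insert]
    exact (ih p q).union ((ih p a).add ((IsSemilinearSet.singleton x).add
      (((ih b a).add (.singleton x)).closure.add (ih b q))))

end PathSum

/-! ## Sums over a list of given types -/

theorem List.perm_of_sum_single_eq {τ : Type*} [DecidableEq τ] {l l' : List τ}
    (h : (l.map fun t => (Pi.single t 1 : τ → ℕ)).sum = (l'.map fun t => Pi.single t 1).sum) :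
    l.Perm l' := by
  have key : ∀ (l : List τ) (t : τ), (l.map fun t => (Pi.single t 1 : τ → ℕ)).sum t = l.count t := by
    intro l t
    induction l with
    | nil => simp
    | cons a l ih =>
      rw [List.map_cons, List.sum_cons, Pi.add_apply, ih, List.count_cons, Pi.single_apply, add_comm]
      by_cases h : t = a
      · simp [h]
      · simp [h, Ne.symm h]
  rw [List.perm_iff_count]
  intro t
  rw [← key, ← key, h]

/-- The pairs consisting of the vector counting the types of the elements of a list and of a sum of
elements of `M`, one in `X t` for each occurrence of the type `t`. -/
def typedSums {τ M : Type*} [DecidableEq τ] [AddCommMonoid M] (X : τ → Set M) :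
    AddSubmonoid ((τ → ℕ) × M) :=
  AddSubmonoid.closure (⋃ t, (fun w => (Pi.single t 1, w)) '' X t)

theorem isSemilinearSet_typedSums {τ M : Type*} [DecidableEq τ] [Finite τ] [AddCommMonoid M]
    {X : τ → Set M} (hX : ∀ t, IsSemilinearSet (X t)) :
    IsSemilinearSet (typedSums X : Set ((τ → ℕ) × M)) := by
  refine IsSemilinearSet.closure (.iUnion fun t => ?_)
  convert ((hX t).image (AddMonoidHom.inr (τ → ℕ) M)).vadd (Pi.single t 1, 0) using 1
  rw [← Set.image_vadd, Set.image_image]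
  simp

/-- A member of the submonoid is a sum along some list of types. The counting vector determines this
list up to a permutation, and the summands can be permuted along with it. -/
theorem mem_typedSums_iff {τ M : Type*} [DecidableEq τ] [AddCommMonoid M] {X : τ → Set M}
    {l : List τ} {W : M} :
    ((l.map fun t => (Pi.single t 1 : τ → ℕ)).sum, W) ∈ typedSums X ↔
      ∃ ws, List.Forall₂ (fun t w => w ∈ X t) l ws ∧ ws.sum = W := by
  constructor
  · intro h
    obtain ⟨L, hL, hs⟩ := AddSubmonoid.exists_list_of_mem_closure h
    have hL' : ∃ K : List (τ × M), (∀ x ∈ K, x.2 ∈ X x.1) ∧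
        L = K.map fun x => (Pi.single x.1 1, x.2) := by
      clear hs h
      induction L with
      | nil => exact ⟨[], by simp, rfl⟩
      | cons a L ih =>
        obtain ⟨K, hK, rfl⟩ := ih fun y hy => hL y (List.mem_cons_of_mem _ hy)
        obtain ⟨t, w, hw, rfl⟩ := Set.mem_iUnion.1 (hL a List.mem_cons_self)
        exact ⟨(t, w) :: K, by simpa [hw] using hK, rfl⟩
    obtain ⟨K, hK, rfl⟩ := hL'
    have hfst := congrArg (AddMonoidHom.fst (τ → ℕ) M) hs
    have hsnd := congrArg (AddMonoidHom.snd (τ → ℕ) M) hs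
    rw [map_list_sum, List.map_map] at hfst hsnd
    have hperm : l.Perm (K.map Prod.fst) := by
      apply List.perm_of_sum_single_eq
      rw [List.map_map]
      exact hfst.symm
    have hrel : List.Forall₂ (fun t (x : τ × M) => x.2 ∈ X t) (K.map Prod.fst) K := by
      clear hperm hfst hsnd hs h hL
      induction K with
      | nil => exact .nil
      | cons a K ih =>
        exact .cons (hK a List.mem_cons_self) (ih fun x hx => hK x (List.mem_cons_of_mem _ hx))
    obtain ⟨K', hK', hp⟩ := List.perm_comp_forall₂ hperm hrel
    refine ⟨K'.map Prod.snd, List.forall₂_map_right_iff.2 hK', ?_⟩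
    rw [(hp.map Prod.snd).sum_eq]
    exact hsnd
  · rintro ⟨ws, h, rfl⟩
    induction h with
    | nil => exact zero_mem _
    | @cons t w l ws hw _ ih =>
      simp only [List.map_cons, List.sum_cons]
      have h1 : ((Pi.single t 1 : τ → ℕ), w) ∈ typedSums X :=
        AddSubmonoid.subset_closure (Set.mem_iUnion.2 ⟨t, w, hw, rfl⟩)
      exact add_mem h1 ih

/-! ## Two-way systems with phases -/

/-- A two-way nondeterministic device without counters. Each state belongs to a phase; phases never
decrease, and within a phase the head moves in one direction only. A run is accepting if it ends
in a halting state and if the vector counting the visits of each state is in `good`. -/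
structure TwoWaySystem (α P : Type*) where
  start : P
  trans : TapeSymbol α → P → SignType → P → Prop
  halt : TapeSymbol α → P → Prop
  phase : P → ℕ
  goesRight : P → Bool
  good : Set (P → ℕ)
  phase_le : ∀ {a p d q}, trans a p d q → phase p ≤ phase q
  goesRight_eq : ∀ {a p d q}, trans a p d q → phase p = phase q → goesRight p = goesRight q
  move_eq : ∀ {a p d q}, trans a p d q → phase p = phase q → d ≠ 0 →
    d = if goesRight p then 1 else -1

namespace TwoWaySystem

variable {α P : Type*} (T : TwoWaySystem α P)

/-- One step on the word `w`; a configuration consists of a state and a position of the head. -/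
def Step (w : List α) (c c' : P × ℕ) : Prop :=
  ∃ d : SignType, T.trans (tapeSymbolAt w c.2) c.1 d c'.1 ∧
    (c'.2 : ℤ) = (c.2 : ℤ) + (d : ℤ) ∧ c'.2 ≤ w.length + 1

/-- `T.Run w c π`: the list `π` is a sequence of successive configurations that begins with `c` and
ends in a halting configuration. -/
inductive Run (w : List α) : P × ℕ → List (P × ℕ) → Prop
  | halt {c : P × ℕ} : T.halt (tapeSymbolAt w c.2) c.1 → Run w c [c]
  | step {c c' : P × ℕ} {π : List (P × ℕ)} : T.Step w c c' → Run w c' π → Run w c (c :: π)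

/-- The number of visits of each state. -/
def visits [DecidableEq P] (π : List (P × ℕ)) : P → ℕ :=
  (π.map fun c => Pi.single c.1 1).sum

/-- A block is a maximal part of a run during which neither the position nor the phase changes. It is
described by the direction from which it is entered (if it is not the first one), the state in which
it is entered and the move and state with which it is left (if it is not the last one). -/
abbrev Block (P : Type*) : Type _ := Option SignType × P × Option (SignType × P)

/-- The transitions that do not leave a block on a cell with symbol `a`. -/
def blockEdges [DecidableEq P] (a : TapeSymbol α) : Set (P × (P → ℕ) × P) :=
  {e | T.trans a e.1 0 e.2.2 ∧ T.phase e.1 = T.phase e.2.2 ∧ e.2.1 = Pi.single e.1 1}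

/-- From the state `p` a block on a cell with symbol `a` can be left in the given way. -/
def Exit (a : TapeSymbol α) (p : P) : Option (SignType × P) → Prop
  | none => T.halt a p
  | some (d, q) => T.trans a p d q ∧ (d ≠ 0 ∨ T.phase q ≠ T.phase p)

/-- The possible numbers of visits of the states during a block. -/
def blockVisits [DecidableEq P] (t : TapeSymbol α × Block P) : Set (P → ℕ) :=
  {v | ∃ r u, PathSum (T.blockEdges t.1) t.2.2.1 r u ∧ T.Exit t.1 r t.2.2.2 ∧
    v = u + Pi.single r 1}

theorem isSemilinearSet_blockVisits [DecidableEq P] [Finite P] (t : TapeSymbol α × Block P) :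
    IsSemilinearSet (T.blockVisits t) := by
  have hE : (T.blockEdges t.1).Finite := by
    apply (Set.finite_range fun e : P × P => (e.1, (Pi.single e.1 1 : P → ℕ), e.2)).subset
    rintro ⟨p, v, q⟩ ⟨_, _, h⟩
    exact ⟨(p, q), by simp_all⟩
  have : T.blockVisits t = ⋃ r ∈ {r | T.Exit t.1 r t.2.2.2},
      ({u | PathSum (T.blockEdges t.1) t.2.2.1 r u} + ({Pi.single r 1} : Set (P → ℕ))) := by
    ext v
    simp only [blockVisits, Set.mem_ofPred_eq, Set.mem_iUnion, Set.mem_add, Set.mem_singleton_iff,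
      exists_prop]
    constructor
    · rintro ⟨r, u, h, he, rfl⟩
      exact ⟨r, he, u, h, _, rfl, rfl⟩
    · rintro ⟨r, he, u, h, _, rfl, rfl⟩
      exact ⟨r, u, h, he, rfl⟩
  rw [this]
  exact .biUnion (Set.toFinite _) fun r _ =>
    (PathSum.isSemilinearSet hE _ _).add (.singleton _)

/-- A sequence of blocks, each with its position, such that each is left to the next one. -/
inductive Linked (n : ℕ) : Option SignType → P → ℕ → List (ℕ × Block P) → Prop
  | last {f : Option SignType} {p : P} {x : ℕ} : x ≤ n + 1 → Linked n f p x [(x, f, p, none)]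
  | cons {f : Option SignType} {p q : P} {x y : ℕ} {d : SignType} {L : List (ℕ × Block P)} :
      x ≤ n + 1 → (y : ℤ) = (x : ℤ) + (d : ℤ) → Linked n (some d) q y L →
      Linked n f p x ((x, f, p, some (d, q)) :: L)

/-- The blocks of a run, the first of which has been entered in state `e`. -/
noncomputable def blocks : Option SignType → P → List (P × ℕ) → List (ℕ × Block P)
  | _, _, [] => []
  | f, e, [c] => [(c.2, f, e, none)]
  | f, e, c :: c' :: π =>
    if c'.2 = c.2 ∧ T.phase c'.1 = T.phase c.1 then blocks f e (c' :: π)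
    else (c.2, f, e, some (SignType.sign ((c'.2 : ℤ) - c.2), c'.1)) ::
      blocks (some (SignType.sign ((c'.2 : ℤ) - c.2))) c'.1 (c' :: π)

variable {T} {w : List α}

/-- The symbol on which a block takes place, together with the block. -/
def blockType (w : List α) (b : ℕ × Block P) : TapeSymbol α × Block P :=
  (tapeSymbolAt w b.1, b.2)

theorem Run.eq_cons {c : P × ℕ} {π : List (P × ℕ)} (h : T.Run w c π) : ∃ π', π = c :: π' := by
  cases h <;> exact ⟨_, rfl⟩

theorem sign_intCast (d : SignType) : SignType.sign (d : ℤ) = d := by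
  cases d <;> rfl

theorem eq_zero_of_intCast {d : SignType} (h : (d : ℤ) = 0) : d = 0 := by
  rw [← sign_intCast d, h, sign_zero]

theorem Step.sign_eq {c c' : P × ℕ} {d : SignType} (h : (c'.2 : ℤ) = (c.2 : ℤ) + (d : ℤ)) :
    SignType.sign ((c'.2 : ℤ) - c.2) = d := by
  rw [h, add_sub_cancel_left, sign_intCast]

/-- The induction passes through the middle of blocks: `e` is the state in which the current block
was entered, and `u` are the visits made in it before `c`. -/
theorem Run.linked_blocks [DecidableEq P] {c : P × ℕ} {π : List (P × ℕ)} (h : T.Run w c π)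
    (hc : c.2 ≤ w.length + 1) (f : Option SignType) {e : P} {u : P → ℕ}
    (he : PathSum (T.blockEdges (tapeSymbolAt w c.2)) e c.1 u) :
    Linked w.length f e c.2 (T.blocks f e π) ∧
      ∃ vs, List.Forall₂ (fun b v => v ∈ T.blockVisits (blockType w b)) (T.blocks f e π) vs ∧
        vs.sum = u + visits π := by
  induction h generalizing f e u with
  | @halt c h =>
    refine ⟨.last hc, [u + Pi.single c.1 1], .cons ⟨c.1, u, he, h, rfl⟩ .nil, by simp [visits]⟩
  | @step c c' π hs h ih =>
    obtain ⟨d, ht, hd, hc'⟩ := hs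
    obtain ⟨π', rfl⟩ := h.eq_cons
    have hv : visits (c :: c' :: π') = Pi.single c.1 1 + visits (c' :: π') := by simp [visits]
    rw [blocks, hv]
    split_ifs with hb
    · obtain rfl : d = 0 := by
        have : (d : ℤ) = 0 := by have := hb.1; omega
        exact eq_zero_of_intCast this
      have := ih hc' f (e := e) (u := u + Pi.single c.1 1) (by
        rw [hb.1]
        refine he.trans ?_
        simpa using PathSum.cons (show (c.1, Pi.single c.1 1, c'.1) ∈ T.blockEdges _ from
          ⟨ht, hb.2.symm, rfl⟩) (.nil _))
      rw [hb.1] at this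
      simpa only [add_assoc] using this
    · rw [Step.sign_eq hd]
      obtain ⟨h1, vs, h2, h3⟩ := ih hc' (some d) (.nil _)
      refine ⟨.cons hc hd h1, (u + Pi.single c.1 1) :: vs, .cons ⟨c.1, u, he, ⟨ht, ?_⟩, rfl⟩ h2, ?_⟩
      · by_contra! hcon
        obtain ⟨rfl, hph⟩ := hcon
        exact hb ⟨by simpa using hd, hph⟩
      · rw [List.sum_cons, h3, zero_add, add_assoc]

/-- Edges of `blockEdges` change neither cell nor phase, so a path of them put in front of a run is
absorbed by its first block. -/
theorem Run.of_pathSum [DecidableEq P] {x : ℕ} {p r : P} {u : P → ℕ} (hx : x ≤ w.length + 1)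
    (h : PathSum (T.blockEdges (tapeSymbolAt w x)) p r u) {π : List (P × ℕ)}
    (hπ : T.Run w (r, x) π) (f : Option SignType) (e : P) :
    ∃ π', T.Run w (p, x) π' ∧ T.blocks f e π' = T.blocks f e π ∧ visits π' = u + visits π := by
  induction h with
  | nil p => exact ⟨π, hπ, rfl, by simp⟩
  | @cons p q r v u he _ ih =>
    obtain ⟨π', h1, h2, h3⟩ := ih hπ
    obtain ⟨ht, hph, hv⟩ := he
    dsimp only at ht hph hv
    subst hv
    obtain ⟨π'', rfl⟩ := h1.eq_cons
    refine ⟨(p, x) :: (q, x) :: π'', .step ⟨0, ht, by simp, hx⟩ h1, ?_, ?_⟩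
    · rw [blocks, if_pos ⟨rfl, hph.symm⟩, h2]
    · rw [add_assoc, ← h3]
      simp [visits]

/-- Converse of `Run.linked_blocks`. The inside of each block can be chosen independently of the
other blocks, and so can its visit vector. -/
theorem Linked.exists_run [DecidableEq P] {f : Option SignType} {p : P} {x : ℕ}
    {L : List (ℕ × Block P)} (h : Linked w.length f p x L) {vs : List (P → ℕ)}
    (hvs : List.Forall₂ (fun b v => v ∈ T.blockVisits (blockType w b)) L vs) :
    ∃ π, T.Run w (p, x) π ∧ T.blocks f p π = L ∧ visits π = vs.sum := by
  induction h generalizing vs with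
  | @last f p x hx =>
    cases hvs with
    | cons h1 h2 =>
      cases h2
      obtain ⟨r, u, hu, he, rfl⟩ := h1
      obtain ⟨π, h1, h2, h3⟩ := Run.of_pathSum hx hu (Run.halt (c := (r, x)) he) f p
      exact ⟨π, h1, by rw [h2, blocks], by rw [h3]; simp [visits]⟩
  | @cons f p q x y d L hx hd hL ih =>
    cases hvs with
    | @cons _ v _ vs h1 h2 =>
      obtain ⟨r, u, hu, ⟨ht, he⟩, rfl⟩ := h1
      obtain ⟨π, g1, g2, g3⟩ := ih h2
      have hy : y ≤ w.length + 1 := by cases hL <;> assumption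
      obtain ⟨π'', rfl⟩ := g1.eq_cons
      obtain ⟨π', h1, h2, h3⟩ := Run.of_pathSum hx hu (Run.step (c := (r, x)) (c' := (q, y)) ⟨d, ht, hd, hy⟩ g1) f p
      refine ⟨π', h1, ?_, ?_⟩
      · rw [h2, blocks, if_neg, Step.sign_eq (c := (r, x)) (c' := (q, y)) hd, g2]
        rintro ⟨h4, h5⟩
        rcases he with he | he
        · apply he
          simp only at h4
          have : (d : ℤ) = 0 := by omega
          exact eq_zero_of_intCast this
        · exact he h5
      · rw [h3, List.sum_cons, ← g3, add_assoc]
        simp [visits]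

end TwoWaySystem

/-! ### The order of the blocks and their recovery from columns -/

namespace TwoWaySystem

variable {α P : Type*} {T : TwoWaySystem α P} {w : List α} {n : ℕ}

/-- The rank of a block increases along each run. -/
def rank (T : TwoWaySystem α P) (n x : ℕ) (p : P) : ℕ :=
  T.phase p * (n + 2) + if T.goesRight p then x else n + 1 - x

theorem phase_eq_of_pathSum [DecidableEq P] {a : TapeSymbol α} {p q : P} {u : P → ℕ}
    (h : PathSum (T.blockEdges a) p q u) : T.phase p = T.phase q ∧ T.goesRight p = T.goesRight q := by
  induction h with
  | nil p => exact ⟨rfl, rfl⟩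
  | cons he _ ih => exact ⟨he.2.1.trans ih.1, (T.goesRight_eq he.1 he.2.1).trans ih.2⟩

/-- Inside a block the phase is constant. The block is left either by a move in the direction of the
phase or by a step to a later phase. -/
theorem rank_lt_rank [DecidableEq P] {x y : ℕ} {a : TapeSymbol α} {f : Option SignType} {p q : P}
    {d : SignType} (hx : x ≤ n + 1) (hd : (y : ℤ) = (x : ℤ) + (d : ℤ))
    (h : (T.blockVisits (a, (f, p, some (d, q)))).Nonempty) : T.rank n x p < T.rank n y q := by
  obtain ⟨_, r, u, hu, ⟨ht, he⟩, rfl⟩ := h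
  obtain ⟨h1, h2⟩ := phase_eq_of_pathSum hu
  dsimp only at h1 h2 ht
  have h3 := T.phase_le ht
  unfold rank
  rcases h3.eq_or_lt with h3 | h3
  · have h4 := he.resolve_right (by simp [h3])
    have h5 := T.move_eq ht h3 h4
    have h6 := T.goesRight_eq ht h3
    rw [h1, h2, h3, ← h6]
    apply Nat.add_lt_add_left
    split_ifs at h5 ⊢ <;> subst h5 <;> simp at hd <;> omega
  · rw [h1]
    -- The position contributes less than `n + 2` to the rank, so one more phase outweighs every
    -- change of position.
    have h4 : (T.phase r + 1) * (n + 2) ≤ T.phase q * (n + 2) := Nat.mul_le_mul_right _ h3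
    have h5 : (if T.goesRight p then x else n + 1 - x) < n + 2 := by split_ifs <;> omega
    rw [add_mul] at h4
    omega

namespace Linked

variable {f : Option SignType} {p : P} {x : ℕ} {L : List (ℕ × Block P)}

theorem eq_cons (h : Linked n f p x L) : ∃ t L', L = (x, f, p, t) :: L' := by
  cases h <;> exact ⟨_, _, rfl⟩

theorem le_of_mem (h : Linked n f p x L) {b : ℕ × Block P} (hb : b ∈ L) : b.1 ≤ n + 1 := by
  induction h with
  | last hx => simp_all
  | cons hx _ _ ih =>
    rcases List.mem_cons.1 hb with rfl | hb
    · exact hx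
    · exact ih hb

theorem exists_next (h : Linked n f p x L) {y : ℕ} {g : Option SignType} {q r : P} {d : SignType}
    (hb : (y, g, q, some (d, r)) ∈ L) :
    ∃ (z : ℕ) (t : _), (z : ℤ) = (y : ℤ) + (d : ℤ) ∧ (z, some d, r, t) ∈ L := by
  induction h with
  | last hx => simp at hb
  | cons hx hy hL ih =>
    rcases List.mem_cons.1 hb with hb | hb
    · simp only [Prod.mk.injEq, Option.some.injEq] at hb
      obtain ⟨rfl, rfl, rfl, rfl, rfl⟩ := hb
      obtain ⟨t, L', rfl⟩ := hL.eq_cons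
      exact ⟨_, t, hy, by simp⟩
    · obtain ⟨z, t, h1, h2⟩ := ih hb
      exact ⟨z, t, h1, List.mem_cons_of_mem _ h2⟩

theorem eq_or_exists_prev (h : Linked n f p x L) {y : ℕ} {g : Option SignType} {q : P}
    {t : Option (SignType × P)} (hb : (y, g, q, t) ∈ L) :
    (y = x ∧ g = f ∧ q = p) ∨ ∃ (z : ℕ) (g' : _) (r : P) (d : SignType), g = some d ∧ (y : ℤ) = (z : ℤ) + (d : ℤ) ∧
      (z, g', r, some (d, q)) ∈ L := by
  induction h with
  | last hx => left; simp_all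
  | @cons f p q' x y' d L hx hy hL ih =>
    rcases List.mem_cons.1 hb with hb | hb
    · left; simp_all
    · right
      rcases ih hb with ⟨rfl, rfl, rfl⟩ | ⟨z, g', r, d, h1, h2, h3⟩
      · exact ⟨x, f, p, d, rfl, hy, by simp⟩
      · exact ⟨z, g', r, d, h1, h2, List.mem_cons_of_mem _ h3⟩

theorem pairwise_rank [DecidableEq P] (h : Linked w.length f p x L)
    (hL : ∀ b ∈ L, (T.blockVisits (blockType w b)).Nonempty) :
    L.Pairwise fun b c => T.rank w.length b.1 b.2.2.1 < T.rank w.length c.1 c.2.2.1 := by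
  rw [← List.isChain_iff_pairwise]
  induction h with
  | last hx => exact .singleton _
  | @cons f p q' x y' d L hx hy h ih =>
    refine List.IsChain.cons (ih fun b hb => hL b (List.mem_cons_of_mem _ hb)) ?_
    obtain ⟨t, L', rfl⟩ := h.eq_cons
    rintro _ ⟨⟩
    exact rank_lt_rank hx hy (hL _ List.mem_cons_self)

/-- A cell and an entry state thus determine at most one block of a run; hence nothing is lost when
the list of blocks is replaced by sets, one for each cell. -/
theorem nodup_map_rank [DecidableEq P] (h : Linked w.length f p x L)
    (hL : ∀ b ∈ L, (T.blockVisits (blockType w b)).Nonempty) :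
    (L.map fun b => T.rank w.length b.1 b.2.2.1).Nodup :=
  (List.pairwise_map.2 (h.pairwise_rank hL)).imp ne_of_lt

end Linked

/-- The sets of blocks of an accepting run at each position. -/
structure IsColumns [DecidableEq P] (T : TwoWaySystem α P) (w : List α)
    (C : ℕ → Finset (Block P)) : Prop where
  empty : ∀ x, w.length + 1 < x → C x = ∅
  unique : ∀ {x f f' p t t'}, (f, p, t) ∈ C x → (f', p, t') ∈ C x → f = f' ∧ t = t'
  next : ∀ {x f p d q}, (f, p, some (d, q)) ∈ C x →
    ∃ (y : ℕ) (t : _), (y : ℤ) = (x : ℤ) + (d : ℤ) ∧ (some d, q, t) ∈ C y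
  prev : ∀ {y d q t}, (some d, q, t) ∈ C y →
    ∃ (x : ℕ) (f : _) (p : P), (y : ℤ) = (x : ℤ) + (d : ℤ) ∧ (f, p, some (d, q)) ∈ C x
  first : ∀ {x p t}, (none, p, t) ∈ C x → x = 0 ∧ p = T.start
  exists_first : ∃ t, (none, T.start, t) ∈ C 0
  nonempty : ∀ {x b}, b ∈ C x → (T.blockVisits (tapeSymbolAt w x, b)).Nonempty

theorem Linked.isColumns [DecidableEq P] {L : List (ℕ × Block P)}
    (h : Linked w.length none T.start 0 L)
    (hL : ∀ b ∈ L, (T.blockVisits (blockType w b)).Nonempty) {C : ℕ → Finset (Block P)}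
    (hC : ∀ x b, b ∈ C x ↔ (x, b) ∈ L) : IsColumns T w C where
  empty x hx := by
    ext b
    simp only [hC, Finset.notMem_empty, iff_false]
    intro hb
    have := h.le_of_mem hb
    dsimp only at this
    omega
  unique {x f f' p t t'} h1 h2 := by
    rw [hC] at h1 h2
    have := List.inj_on_of_nodup_map (h.nodup_map_rank hL) h1 h2 rfl
    simp_all
  next h1 := by
    simp only [hC] at h1 ⊢
    exact h.exists_next h1
  prev h1 := by
    simp only [hC] at h1 ⊢
    rcases h.eq_or_exists_prev h1 with ⟨_, h2, _⟩ | ⟨z, g', r, d, h2, h3, h4⟩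
    · cases h2
    · cases h2
      exact ⟨z, g', r, h3, h4⟩
  first h1 := by
    rw [hC] at h1
    rcases h.eq_or_exists_prev h1 with ⟨h2, _, h3⟩ | ⟨z, g', r, d, h2, h3, h4⟩
    · exact ⟨h2, h3⟩
    · cases h2
  exists_first := by
    obtain ⟨t, L', rfl⟩ := h.eq_cons
    exact ⟨t, by simp [hC]⟩
  nonempty h1 := hL _ ((hC _ _).1 h1)

theorem IsColumns.le_of_mem [DecidableEq P] {C : ℕ → Finset (Block P)} (h : IsColumns T w C) {x : ℕ}
    {b : Block P} (hb : b ∈ C x) : x ≤ w.length + 1 := by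
  by_contra! hx
  rw [h.empty x hx] at hb
  simp at hb

theorem exists_rank_lt [Finite P] (T : TwoWaySystem α P) (n : ℕ) :
    ∃ R, ∀ x p, x ≤ n + 1 → T.rank n x p < R := by
  obtain ⟨m, hm⟩ := (Set.finite_range T.phase).bddAbove
  refine ⟨(m + 1) * (n + 2), fun x p hx => ?_⟩
  have h1 := hm ⟨p, rfl⟩
  unfold rank
  have h4 : T.phase p * (n + 2) ≤ m * (n + 2) := Nat.mul_le_mul_right _ h1
  have h5 : (if T.goesRight p then x else n + 1 - x) < n + 2 := by split_ifs <;> omega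
  rw [add_mul]
  omega

/-- Follow the successors from the first block; ranks increase and are bounded, so this ends. No
other blocks exist: going back along predecessors the rank decreases, so every block leads back to
the first one, and by `unique` it lies on the path constructed. In particular no separate cycle of
blocks can satisfy the conditions. -/
theorem IsColumns.exists_linked [DecidableEq P] [Finite P] {C : ℕ → Finset (Block P)}
    (h : IsColumns T w C) :
    ∃ L, Linked w.length none T.start 0 L ∧ ∀ x b, b ∈ C x ↔ (x, b) ∈ L := by
  obtain ⟨R, hR⟩ := T.exists_rank_lt w.length
  have forward : ∀ k x f p t, R - T.rank w.length x p = k → (f, p, t) ∈ C x →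
      ∃ L, Linked w.length f p x L ∧ ∀ b ∈ L, b.2 ∈ C b.1 := by
    intro k
    induction k using Nat.strong_induction_on with
    | _ k ih =>
      intro x f p t hk hb
      rcases t with _ | ⟨d, q⟩
      · exact ⟨_, .last (h.le_of_mem hb), by simpa using hb⟩
      · obtain ⟨y, t, hy, hb'⟩ := h.next hb
        have h1 := rank_lt_rank (h.le_of_mem hb) hy (h.nonempty hb)
        have h2 := hR y q (h.le_of_mem hb')
        obtain ⟨L, hL, hL'⟩ := ih _ (by omega) y (some d) q t rfl hb'
        exact ⟨_, .cons (h.le_of_mem hb) hy hL, by simpa [hb] using hL'⟩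
  obtain ⟨t₀, ht₀⟩ := h.exists_first
  obtain ⟨L, hL, hLC⟩ := forward _ 0 none T.start t₀ rfl ht₀
  refine ⟨L, hL, fun x b => ⟨?_, fun hb => hLC _ hb⟩⟩
  obtain ⟨f, p, t⟩ := b
  induction hk : T.rank w.length x p using Nat.strong_induction_on generalizing x f p t with
  | _ k ih =>
    intro hb
    rcases f with _ | d
    · obtain ⟨rfl, rfl⟩ := h.first hb
      obtain ⟨t', L', rfl⟩ := hL.eq_cons
      obtain ⟨-, rfl⟩ := h.unique hb (hLC _ List.mem_cons_self)
      simp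
    · obtain ⟨z, f, r, hz, hb'⟩ := h.prev hb
      have h1 := rank_lt_rank (h.le_of_mem hb') hz (h.nonempty hb')
      have h2 := ih _ (by omega) z f r _ rfl hb'
      obtain ⟨z', t', hz', hb''⟩ := hL.exists_next h2
      obtain rfl : z' = x := by omega
      obtain ⟨-, rfl⟩ := h.unique hb (hLC _ hb'')
      exact hb''

theorem sum_columns {M : Type*} [AddCommMonoid M] [DecidableEq P] {L : List (ℕ × Block P)} (hL : L.Nodup)
    (hn : ∀ b ∈ L, b.1 < n) {C : ℕ → Finset (Block P)} (hC : ∀ x b, b ∈ C x ↔ (x, b) ∈ L)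
    (g : ℕ → Block P → M) :
    ∑ x ∈ Finset.range n, ∑ b ∈ C x, g x b = (L.map fun b => g b.1 b.2).sum := by
  rw [← List.sum_toFinset _ hL, Finset.sum_sigma']
  refine Finset.sum_bij' (fun b _ => (b.1, b.2)) (fun b _ => ⟨b.1, b.2⟩) ?_ ?_ ?_ ?_ ?_
  · rintro ⟨x, b⟩ h
    simp_all
  · rintro ⟨x, b⟩ h
    simp only [List.mem_toFinset] at h
    simpa [hC, h] using hn _ h
  all_goals simp

variable [DecidableEq P]

/-- The vector counting the blocks of a column over the symbol `a`. -/
def columnCount (a : TapeSymbol α) (c : Finset (Block P)) [DecidableEq (TapeSymbol α × Block P)] :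
    TapeSymbol α × Block P → ℕ :=
  ∑ b ∈ c, Pi.single (a, b) 1

theorem Linked.sum_columnCount {L : List (ℕ × Block P)} [DecidableEq (TapeSymbol α × Block P)]
    (h : Linked w.length none T.start 0 L)
    (hL : ∀ b ∈ L, (T.blockVisits (blockType w b)).Nonempty) {C : ℕ → Finset (Block P)}
    (hC : ∀ x b, b ∈ C x ↔ (x, b) ∈ L) :
    ∑ x ∈ Finset.range (w.length + 2), columnCount (tapeSymbolAt w x) (C x) =
      ((L.map (blockType w)).map fun t => Pi.single t 1).sum := by
  rw [List.map_map]
  exact sum_columns (h.nodup_map_rank hL).of_map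
    (fun b hb => Nat.lt_succ_of_le (h.le_of_mem hb)) hC
    fun x b => Pi.single (tapeSymbolAt w x, b) 1

theorem nonempty_of_forall₂ {L : List (ℕ × Block P)} {vs : List (P → ℕ)}
    (h : List.Forall₂ (fun b v => v ∈ T.blockVisits (blockType w b)) L vs) :
    ∀ b ∈ L, (T.blockVisits (blockType w b)).Nonempty := by
  induction h with
  | nil => simp
  | cons h _ ih => exact List.forall_mem_cons.2 ⟨⟨_, h⟩, ih⟩

/-- The columns fix the sequence of blocks. Membership in `typedSums` depends only on the numbers of
blocks of each type, yet it allows `v` to be distributed over the blocks of this sequence. The run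
need not be unique, but it determines `C`. -/
theorem IsColumns.exists_run [Finite P] [DecidableEq (TapeSymbol α × Block P)]
    {C : ℕ → Finset (Block P)} (h : IsColumns T w C) {v : P → ℕ}
    (hv : (∑ x ∈ Finset.range (w.length + 2), columnCount (tapeSymbolAt w x) (C x), v) ∈
      typedSums T.blockVisits) :
    ∃ π, T.Run w (T.start, 0) π ∧ visits π = v ∧
      ∀ x b, b ∈ C x ↔ (x, b) ∈ T.blocks none T.start π := by
  obtain ⟨L, hL, hC⟩ := h.exists_linked
  have hne : ∀ b ∈ L, (T.blockVisits (blockType w b)).Nonempty := fun b hb =>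
    h.nonempty ((hC _ _).2 hb)
  rw [hL.sum_columnCount hne hC, mem_typedSums_iff] at hv
  obtain ⟨vs, hvs, rfl⟩ := hv
  rw [List.forall₂_map_left_iff] at hvs
  obtain ⟨π, h1, h2, h3⟩ := hL.exists_run hvs
  exact ⟨π, h1, h3, fun x b => by rw [h2, hC]⟩

theorem Run.exists_isColumns [DecidableEq (TapeSymbol α × Block P)] {π : List (P × ℕ)}
    (h : T.Run w (T.start, 0) π) :
    ∃ C, IsColumns T w C ∧
      (∑ x ∈ Finset.range (w.length + 2), columnCount (tapeSymbolAt w x) (C x), visits π) ∈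
        typedSums T.blockVisits := by
  obtain ⟨hL, vs, hvs, hs⟩ := h.linked_blocks (Nat.zero_le _) none (.nil _)
  have hne := nonempty_of_forall₂ hvs
  have hC : ∀ x b, b ∈ (((T.blocks none T.start π).filter fun b => b.1 = x).map Prod.snd).toFinset ↔
      (x, b) ∈ T.blocks none T.start π := by
    intro x b
    simp only [List.mem_toFinset, List.mem_map, List.mem_filter, decide_eq_true_eq]
    constructor
    · rintro ⟨⟨y, b⟩, ⟨h, rfl⟩, rfl⟩
      exact h
    · intro h
      exact ⟨(x, b), ⟨h, rfl⟩, rfl⟩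
  refine ⟨_, hL.isColumns hne hC, ?_⟩
  rw [hL.sum_columnCount hne hC, mem_typedSums_iff]
  exact ⟨vs, List.forall₂_map_left_iff.2 hvs, by simpa using hs⟩

end TwoWaySystem

/-! ### Columns described by local conditions -/

namespace TwoWaySystem

variable {α P : Type*} {T : TwoWaySystem α P} {w : List α}

/-- The moves between two adjacent columns match. -/
def Compat (c c' : Finset (Block P)) : Prop :=
  (∀ f p q, (f, p, some (1, q)) ∈ c → ∃ t, (some 1, q, t) ∈ c') ∧
  (∀ q t, (some 1, q, t) ∈ c' → ∃ f p, (f, p, some (1, q)) ∈ c) ∧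
  (∀ f p q, (f, p, some (-1, q)) ∈ c' → ∃ t, (some (-1), q, t) ∈ c) ∧
  (∀ q t, (some (-1), q, t) ∈ c → ∃ f p, (f, p, some (-1, q)) ∈ c')

/-- The conditions on a single column over the symbol `a`. -/
structure IsLocal [DecidableEq P] (T : TwoWaySystem α P) (a : TapeSymbol α)
    (c : Finset (Block P)) : Prop where
  unique : ∀ {f f' p t t'}, (f, p, t) ∈ c → (f', p, t') ∈ c → f = f' ∧ t = t'
  next : ∀ {f p q}, (f, p, some (0, q)) ∈ c → ∃ t, (some 0, q, t) ∈ c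
  prev : ∀ {q t}, (some 0, q, t) ∈ c → ∃ f p, (f, p, some (0, q)) ∈ c
  nonempty : ∀ {b}, b ∈ c → (T.blockVisits (a, b)).Nonempty

/-- The column does not contain the first block of a run. -/
def NotFirst (c : Finset (Block P)) : Prop := ∀ p t, (none, p, t) ∉ c

/-- The conditions on the column of the left end-marker. -/
def IsFirst (T : TwoWaySystem α P) (c : Finset (Block P)) : Prop :=
  Compat ∅ c ∧ (∀ p t, (none, p, t) ∈ c → p = T.start) ∧ ∃ t, (none, T.start, t) ∈ c

/-- A move changes the position by at most one, so successors and predecessors lie in the same or in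
an adjacent column. Compatibility with `∅` at both ends says that the head neither leaves the tape
nor enters it from outside. -/
theorem isColumns_iff [DecidableEq P] {C : ℕ → Finset (Block P)} :
    IsColumns T w C ↔ (∀ x, w.length + 1 < x → C x = ∅) ∧ T.IsFirst (C 0) ∧
      (∀ x ≤ w.length, NotFirst (C (x + 1))) ∧
      (∀ x ≤ w.length + 1, T.IsLocal (tapeSymbolAt w x) (C x)) ∧
      ∀ x ≤ w.length + 1, Compat (C x) (C (x + 1)) := by
  constructor
  · intro h
    refine ⟨h.empty, ⟨⟨?_, ?_, ?_, ?_⟩, ?_, h.exists_first⟩, ?_, ?_, ?_⟩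
    · simp
    · intro q t hq
      obtain ⟨x, f, p, hx, -⟩ := h.prev hq
      simp at hx
      omega
    · intro f p q hq
      obtain ⟨x, t, hx, -⟩ := h.next hq
      simp at hx
    · simp
    · exact fun p t hp => (h.first hp).2
    · exact fun x _ p t hp => absurd (h.first hp).1 (by simp)
    · refine fun x _ => ⟨h.unique, fun hq => ?_, fun hq => ?_, h.nonempty⟩
      · obtain ⟨y, t, hy, ht⟩ := h.next hq
        obtain rfl : y = x := by simpa using hy
        exact ⟨t, ht⟩
      · obtain ⟨y, f, p, hy, ht⟩ := h.prev hq
        obtain rfl : x = y := by simpa using hy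
        exact ⟨f, p, ht⟩
    · refine fun x _ => ⟨fun f p q hq => ?_, fun q t hq => ?_, fun f p q hq => ?_, fun q t hq => ?_⟩
      · obtain ⟨y, t, hy, ht⟩ := h.next hq
        obtain rfl : y = x + 1 := by simp at hy; omega
        exact ⟨t, ht⟩
      · obtain ⟨y, f, p, hy, ht⟩ := h.prev hq
        obtain rfl : x = y := by simp at hy; omega
        exact ⟨f, p, ht⟩
      · obtain ⟨y, t, hy, ht⟩ := h.next hq
        obtain rfl : y = x := by simp at hy; omega
        exact ⟨t, ht⟩
      · obtain ⟨y, f, p, hy, ht⟩ := h.prev hq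
        obtain rfl : y = x + 1 := by simp at hy; omega
        exact ⟨f, p, ht⟩
  · rintro ⟨h1, ⟨h2, h3, h4⟩, h5, h6, h7⟩
    have hle : ∀ {x b}, b ∈ C x → x ≤ w.length + 1 := by
      intro x b hb
      by_contra! hx
      rw [h1 x hx] at hb
      simp at hb
    refine ⟨h1, fun h => (h6 _ (hle h)).unique h, ?_, ?_, ?_, h4, fun h => (h6 _ (hle h)).nonempty h⟩
    · intro x f p d q h
      have hx := hle h
      -- The cases are in the order `0`, `-1`, `1`.
      rcases d with _ | _ | _
      · obtain ⟨t, ht⟩ := (h6 x hx).next h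
        exact ⟨x, t, by simp, ht⟩
      · rcases x with _ | x
        · obtain ⟨t, ht⟩ := h2.2.2.1 _ _ _ h
          simp at ht
        · obtain ⟨t, ht⟩ := (h7 x (by omega)).2.2.1 _ _ _ h
          exact ⟨x, t, by simp, ht⟩
      · obtain ⟨t, ht⟩ := (h7 x hx).1 _ _ _ h
        exact ⟨x + 1, t, by simp, ht⟩
    · intro x d q t h
      have hx := hle h
      rcases d with _ | _ | _
      · obtain ⟨f, p, ht⟩ := (h6 x hx).prev h
        exact ⟨x, f, p, by simp, ht⟩
      · obtain ⟨f, p, ht⟩ := (h7 x hx).2.2.2 _ _ h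
        exact ⟨x + 1, f, p, by simp, ht⟩
      · rcases x with _ | x
        · obtain ⟨f, p, ht⟩ := h2.2.1 _ _ h
          simp at ht
        · obtain ⟨f, p, ht⟩ := (h7 x (by omega)).2.1 _ _ h
          exact ⟨x, f, p, by simp, ht⟩
    · intro x p t h
      rcases x with _ | x
      · exact ⟨rfl, h3 p t h⟩
      · have := hle h
        exact (h5 x (by omega) p t h).elim

/-- The sequence of columns over the letters `w`, between the columns `c` and `r`. -/
inductive ColumnChain [DecidableEq P] (T : TwoWaySystem α P) (r : Finset (Block P)) :
    Finset (Block P) → List α → List (Finset (Block P)) → Prop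
  | nil {c : Finset (Block P)} : Compat c r → ColumnChain T r c [] []
  | cons {a : α} {w : List α} {c c' : Finset (Block P)} {cs : List (Finset (Block P))} :
      Compat c c' → NotFirst c' → T.IsLocal (.letter a) c' → ColumnChain T r c' w cs →
      ColumnChain T r c (a :: w) (c' :: cs)

theorem columnChain_of_forall [DecidableEq P] {C : ℕ → Finset (Block P)}
    (h : ∀ x < w.length, NotFirst (C (x + 1)) ∧ T.IsLocal (tapeSymbolAt w (x + 1)) (C (x + 1)))
    (h' : ∀ x ≤ w.length, Compat (C x) (C (x + 1))) :
    ColumnChain T (C (w.length + 1)) (C 0) w ((List.range w.length).map fun x => C (x + 1)) := by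
  induction w generalizing C with
  | nil => exact .nil (h' 0 le_rfl)
  | cons a w ih =>
    rw [List.length_cons, List.range_succ_eq_map, List.map_cons, List.map_map]
    refine .cons (h' 0 (by simp)) (h 0 (by simp)).1 (h 0 (by simp)).2
      (ih (C := fun x => C (x + 1)) (fun x hx => ?_) fun x hx => ?_)
    · exact h (x + 1) (by simpa using hx)
    · exact h' (x + 1) (by simpa using hx)

theorem ColumnChain.exists_forall [DecidableEq P] {r c : Finset (Block P)}
    {cs : List (Finset (Block P))} (h : ColumnChain T r c w cs) :
    ∃ C : ℕ → Finset (Block P), C 0 = c ∧ C (w.length + 1) = r ∧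
      (∀ x, w.length + 1 < x → C x = ∅) ∧ cs = (List.range w.length).map (fun x => C (x + 1)) ∧
      (∀ x < w.length, NotFirst (C (x + 1)) ∧ T.IsLocal (tapeSymbolAt w (x + 1)) (C (x + 1))) ∧
      ∀ x ≤ w.length, Compat (C x) (C (x + 1)) := by
  induction h with
  | @nil c h =>
    refine ⟨fun x => match x with | 0 => c | 1 => r | _ => ∅, rfl, rfl, ?_, rfl, ?_, ?_⟩
    · rintro (_ | _ | x) hx
      · simp at hx
      · simp at hx
      · rfl
    · simp
    · intro x hx
      obtain rfl : x = 0 := by simpa using hx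
      exact h
  | @cons a w c c' cs h1 h2 h3 _ ih =>
    obtain ⟨C, hC0, hr, he, hcs, hl, hc⟩ := ih
    refine ⟨fun x => match x with | 0 => c | x + 1 => C x, rfl, hr, ?_, ?_, ?_, ?_⟩
    · rintro (_ | x) hx
      · simp at hx
      · exact he x (by simpa using hx)
    · rw [List.length_cons, List.range_succ_eq_map, List.map_cons, List.map_map, hcs, ← hC0]
      rfl
    · rintro (_ | x) hx
      · rw [← hC0] at h2 h3
        exact ⟨h2, h3⟩
      · exact hl x (by simpa using hx)
    · rintro (_ | x) hx
      · rw [← hC0] at h1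
        exact h1
      · exact hc x (by simpa using hx)

section

variable [DecidableEq (TapeSymbol α × Block P)]

theorem sum_range_columnCount (C : ℕ → Finset (Block P)) :
    ∑ x ∈ Finset.range w.length, columnCount (tapeSymbolAt w (x + 1)) (C (x + 1)) =
      (List.zipWith (fun a c => columnCount (.letter a) c) w
        ((List.range w.length).map fun x => C (x + 1))).sum := by
  induction w generalizing C with
  | nil => simp
  | cons a w ih =>
    rw [List.length_cons, Finset.sum_range_succ', List.range_succ_eq_map, List.map_cons,
      List.map_map, List.zipWith_cons_cons, List.sum_cons, add_comm]
    congr 1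
    exact ih fun x => C (x + 1)

theorem tapeSymbolAt_length_add_one : tapeSymbolAt w (w.length + 1) = .rightEnd := by
  simp [tapeSymbolAt]

theorem sum_columnCount (C : ℕ → Finset (Block P)) :
    ∑ x ∈ Finset.range (w.length + 2), columnCount (tapeSymbolAt w x) (C x) =
      columnCount .leftEnd (C 0) + columnCount .rightEnd (C (w.length + 1)) +
      (List.zipWith (fun a c => columnCount (.letter a) c) w
        ((List.range w.length).map fun x => C (x + 1))).sum := by
  rw [Finset.sum_range_succ, Finset.sum_range_succ', sum_range_columnCount,
    tapeSymbolAt_length_add_one]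
  simp only [tapeSymbolAt]
  abel

end

end TwoWaySystem

/-! ### The Parikh automaton of a two-way system -/

instance TapeSymbol.instFinite {α : Type*} [Finite α] : Finite (TapeSymbol α) := by
  refine Finite.of_surjective (fun x : Option (Option α) => match x with
    | none => TapeSymbol.leftEnd
    | some none => TapeSymbol.rightEnd
    | some (some a) => TapeSymbol.letter a) ?_
  rintro (_ | a | _)
  exacts [⟨none, rfl⟩, ⟨some (some a), rfl⟩, ⟨some none, rfl⟩]

namespace TwoWaySystem

/-- The zero vector is put into the constraint for the sake of the empty word; by this lemma it
never arises from the columns of a non-empty word. -/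
theorem columnCount_ne_zero {α P : Type*} [DecidableEq (TapeSymbol α × Block P)] {a : TapeSymbol α}
    {c : Finset (Block P)} {b : Block P} (hb : b ∈ c) : columnCount a c ≠ 0 := by
  intro h
  have := congrFun h (a, b)
  rw [columnCount, Finset.sum_apply, Pi.zero_apply, Finset.sum_eq_zero_iff] at this
  simpa using this b hb

variable {α P : Type*} [DecidableEq P] [DecidableEq (TapeSymbol α × Block P)]
  {T : TwoWaySystem α P} {w : List α} {d : ℕ}

/-- The words with a run that satisfies the condition on the numbers of visits. -/
def accepts (T : TwoWaySystem α P) : Language α :=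
  {w | ∃ π, T.Run w (T.start, 0) π ∧ visits π ∈ T.good}

/-- The states of the Parikh automaton: the column of the left end-marker, the column of the right
end-marker and the current column. -/
abbrev PAState (P : Type*) : Type _ :=
  Option (Finset (Block P) × Finset (Block P) × Finset (Block P))

/-- The transitions of the Parikh automaton. -/
inductive PATrans (T : TwoWaySystem α P) (φ : (TapeSymbol α × Block P → ℕ) ≃+ (Fin d → ℕ)) :
    PAState P → α × (Fin d → ℕ) → PAState P → Prop
  | first {a : α} {l r c : Finset (Block P)} : T.IsFirst l → T.IsLocal .leftEnd l → NotFirst r →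
      T.IsLocal .rightEnd r → Compat r ∅ → Compat l c → NotFirst c → T.IsLocal (.letter a) c →
      PATrans T φ none (a, φ (columnCount .leftEnd l + columnCount .rightEnd r +
        columnCount (.letter a) c)) (some (l, r, c))
  | next {a : α} {l r c c' : Finset (Block P)} : Compat c c' → NotFirst c' →
      T.IsLocal (.letter a) c' →
      PATrans T φ (some (l, r, c)) (a, φ (columnCount (.letter a) c')) (some (l, r, c'))

/-- The target state contains all the columns that enter into the vector. This yields the finiteness
of the set of transitions. -/
theorem PATrans.eq_of_eq {φ : (TapeSymbol α × Block P → ℕ) ≃+ (Fin d → ℕ)} {p q : PAState P}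
    {x y : α × (Fin d → ℕ)} (h : PATrans T φ p x q) (h' : PATrans T φ p y q) (hxy : x.1 = y.1) :
    x = y := by
  cases h <;> cases h' <;> cases hxy <;> rfl

/-- The vectors counting blocks that are the blocks of runs which satisfy the condition on the
numbers of visits. -/
def goodCounts (T : TwoWaySystem α P) : Set (TapeSymbol α × Block P → ℕ) :=
  {n | ∃ v ∈ T.good, (n, v) ∈ typedSums T.blockVisits}

theorem isSemilinearSet_goodCounts [Finite α] [Finite P] (hT : IsSemilinearSet T.good) :
    IsSemilinearSet T.goodCounts := by
  have h1 := isSemilinearSet_typedSums fun t => T.isSemilinearSet_blockVisits t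
  have h2 := hT.preimage (AddMonoidHom.snd (TapeSymbol α × Block P → ℕ) (P → ℕ))
  convert (h1.inter h2).image (AddMonoidHom.fst _ _) using 1
  ext n
  constructor
  · rintro ⟨v, hv, h⟩
    exact ⟨(n, v), ⟨h, hv⟩, rfl⟩
  · rintro ⟨⟨n, v⟩, ⟨h, hv⟩, rfl⟩
    exact ⟨v, hv, h⟩

/-- The Parikh automaton of a two-way system. -/
def toParikhAutomaton [Finite α] [Finite P] (T : TwoWaySystem α P) (hT : IsSemilinearSet T.good)
    (φ : (TapeSymbol α × Block P → ℕ) ≃+ (Fin d → ℕ)) : ParikhAutomaton α (PAState P) d where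
  start := none
  final := {s | match s with
    | none => [] ∈ T.accepts
    | some (_, r, c) => Compat c r}
  -- The run on the empty word has no transition that could count blocks: whether it is accepting is
  -- decided by the finality of `none`, and `0` must then be allowed.
  constraint := φ '' ({0} ∪ T.goodCounts)
  semilinear := ((IsSemilinearSet.singleton 0).union (isSemilinearSet_goodCounts hT)).image φ
  trans := {t | PATrans T φ t.1 t.2.1 t.2.2}
  finite_trans := by
    apply Set.Finite.of_finite_image (f := fun t => (t.1, t.2.1.1, t.2.2)) (Set.toFinite _)
    rintro ⟨p, x, q⟩ h ⟨p', y, q'⟩ h' heq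
    simp only [Prod.mk.injEq] at heq
    obtain ⟨rfl, hxy, rfl⟩ := heq
    have := PATrans.eq_of_eq h h' hxy
    dsimp only at this
    rw [this]

variable [Finite α] [Finite P] {hT : IsSemilinearSet T.good}
  {φ : (TapeSymbol α × Block P → ℕ) ≃+ (Fin d → ℕ)}

/-- The part of a run of the Parikh automaton that follows the given columns. -/
def runOfColumns (φ : (TapeSymbol α × Block P → ℕ) ≃+ (Fin d → ℕ)) (l r : Finset (Block P))
    (w : List α) (cs : List (Finset (Block P))) : List ((α × (Fin d → ℕ)) × PAState P) :=
  List.zipWith (fun a c => ((a, φ (columnCount (.letter a) c)), some (l, r, c))) w cs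

theorem exists_columnChain {l r c : Finset (Block P)} {π : List ((α × (Fin d → ℕ)) × PAState P)}
    {q : PAState P} (h : (T.toParikhAutomaton hT φ).IsRun (some (l, r, c)) π q)
    (hq : q ∈ (T.toParikhAutomaton hT φ).final) :
    ∃ cs, ColumnChain T r c (π.map fun s => s.1.1) cs ∧
      π = runOfColumns φ l r (π.map fun s => s.1.1) cs := by
  induction π generalizing c with
  | nil =>
    cases h
    exact ⟨[], .nil hq, rfl⟩
  | cons s π ih =>
    obtain ⟨x, s⟩ := s
    cases h with
    | cons ht h =>
      cases ht with
      | next h1 h2 h3 =>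
        obtain ⟨cs, h4, h5⟩ := ih h
        exact ⟨_ :: cs, .cons h1 h2 h3 h4, congrArg _ h5⟩

theorem ColumnChain.isRun {l r c : Finset (Block P)} {cs : List (Finset (Block P))}
    (h : ColumnChain T r c w cs) :
    (∃ q ∈ (T.toParikhAutomaton hT φ).final,
      (T.toParikhAutomaton hT φ).IsRun (some (l, r, c)) (runOfColumns φ l r w cs) q) ∧
      (runOfColumns φ l r w cs).map (fun s => s.1.1) = w ∧
      ((runOfColumns φ l r w cs).map fun s => s.1.2).sum =
        φ (List.zipWith (fun a c => columnCount (.letter a) c) w cs).sum := by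
  induction h with
  | @nil c h => exact ⟨⟨some (l, r, c), h, .nil _⟩, rfl, by simp [runOfColumns]⟩
  | cons h1 h2 h3 _ ih =>
    obtain ⟨⟨q, hq, h4⟩, h5, h6⟩ := ih
    refine ⟨⟨q, hq, .cons (.next h1 h2 h3) h4⟩, ?_, ?_⟩
    · exact congrArg _ h5
    · rw [List.zipWith_cons_cons, List.sum_cons, map_add, ← h6]
      rfl

/-- The run of the Parikh automaton given by a sequence of columns. -/
def runOf (φ : (TapeSymbol α × Block P → ℕ) ≃+ (Fin d → ℕ)) (w : List α)
    (C : ℕ → Finset (Block P)) : List ((α × (Fin d → ℕ)) × PAState P) :=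
  match w with
  | [] => []
  | a :: w => ((a, φ (columnCount .leftEnd (C 0) + columnCount .rightEnd (C (w.length + 2)) +
        columnCount (.letter a) (C 1))), some (C 0, C (w.length + 2), C 1)) ::
      runOfColumns φ (C 0) (C (w.length + 2)) w ((List.range w.length).map fun x => C (x + 2))

/-- There are no transitions for the end-markers. The first transition therefore guesses and counts
their two columns along with that of the first letter; the right one is kept in the state and is
compared with the last column by the condition for final states. -/
theorem isAcceptingRun_iff (hw : w ≠ []) {π : List ((α × (Fin d → ℕ)) × PAState P)} :
    (T.toParikhAutomaton hT φ).IsAcceptingRun w π ↔ ∃ C, IsColumns T w C ∧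
      ∑ x ∈ Finset.range (w.length + 2), columnCount (tapeSymbolAt w x) (C x) ∈ T.goodCounts ∧
      π = runOf φ w C := by
  obtain ⟨a, w, rfl⟩ := List.exists_cons_of_ne_nil hw
  have hsum : ∀ C : ℕ → Finset (Block P),
      ∑ x ∈ Finset.range ((a :: w).length + 2), columnCount (tapeSymbolAt (a :: w) x) (C x) =
        columnCount .leftEnd (C 0) + columnCount .rightEnd (C (w.length + 2)) +
          columnCount (.letter a) (C 1) + (List.zipWith (fun a c => columnCount (.letter a) c) w
            ((List.range w.length).map fun x => C (x + 2))).sum := by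
    intro C
    rw [sum_columnCount, List.length_cons, List.range_succ_eq_map, List.map_cons, List.map_map,
      List.zipWith_cons_cons, List.sum_cons, ← add_assoc]
    rfl
  constructor
  · rintro ⟨⟨q, hq, hr⟩, hm, hc⟩
    cases hr with
    | nil => simp at hm
    | @cons _ _ _ x π ht hr =>
      rw [List.map_cons, List.cons.injEq] at hm
      obtain ⟨rfl, rfl⟩ := hm
      rcases ht with @⟨a, l, r, c, h1, h2, h3, h4, h5, h6, h7, h8⟩
      obtain ⟨cs, hcs, hπ⟩ := exists_columnChain hr hq
      obtain ⟨C, rfl, rfl, he, hC, hl, hcompat⟩ := (ColumnChain.cons h6 h7 h8 hcs).exists_forall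
      have hsum' := (hcs.isRun (hT := hT) (φ := φ) (l := C 0)).2.2
      rw [← hπ] at hsum'
      rw [List.length_cons, List.range_succ_eq_map, List.map_cons, List.map_map,
        List.cons.injEq] at hC
      obtain ⟨rfl, rfl⟩ := hC
      refine ⟨C, isColumns_iff.2 ⟨he, h1, ?_, ?_, ?_⟩, ?_, congrArg _ hπ⟩
      · intro x hx
        rcases hx.eq_or_lt with rfl | hx
        · exact h3
        · exact (hl x hx).1
      · rintro (_ | x) hx
        · exact h2
        · rcases (Nat.le_of_succ_le_succ hx).eq_or_lt with rfl | hx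
          · rw [tapeSymbolAt_length_add_one]
            exact h4
          · exact (hl x hx).2
      · intro x hx
        rcases hx.eq_or_lt with rfl | hx
        · rw [he _ (Nat.lt_succ_self _)]
          exact h5
        · exact hcompat x (Nat.le_of_lt_succ hx)
      · rw [hsum]
        rw [List.map_cons, List.sum_cons, hsum', ← map_add] at hc
        obtain ⟨n, hn, hn'⟩ := hc
        rw [φ.injective hn'] at hn
        -- The vector is not zero, because the column of the left end-marker contains the first
        -- block.
        refine hn.resolve_left fun h0 => ?_
        obtain ⟨t, ht⟩ := h1.2.2
        apply columnCount_ne_zero (a := (.leftEnd : TapeSymbol α)) ht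
        ext b
        have := congrFun h0 b
        simp only [Pi.add_apply, Pi.zero_apply, Nat.add_eq_zero_iff] at this
        exact this.1.1.1
  · rintro ⟨C, hC, hn, rfl⟩
    obtain ⟨he, h1, h2, h3, h4⟩ := isColumns_iff.1 hC
    have hchain := columnChain_of_forall (fun x hx => ⟨h2 x hx.le, h3 (x + 1) (by omega)⟩)
      fun x hx => h4 x (by omega)
    rw [List.length_cons, List.range_succ_eq_map, List.map_cons, List.map_map] at hchain
    cases hchain with
    | cons g1 g2 g3 g4 =>
      obtain ⟨⟨q, hq, g5⟩, g6, g7⟩ := g4.isRun (hT := hT) (φ := φ) (l := C 0)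
      have h5 := h3 ((a :: w).length + 1) le_rfl
      rw [tapeSymbolAt_length_add_one] at h5
      have h6 := h4 ((a :: w).length + 1) le_rfl
      rw [he _ (Nat.lt_succ_self _)] at h6
      refine ⟨⟨q, hq, .cons (.first h1 (h3 0 (Nat.zero_le _)) (h2 _ le_rfl) h5 h6 g1 g2 g3) g5⟩,
        congrArg _ g6, ?_⟩
      rw [runOf, List.map_cons, List.sum_cons]
      refine ⟨_, Or.inr hn, ?_⟩
      rw [hsum, map_add]
      exact congrArg _ g7.symm

/-- If every word has at most one accepting run, the language of a two-way system is accepted by a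
weakly-unambiguous Parikh automaton. -/
theorem isWeaklyUnambiguousPALanguage {α : Type*} [Finite α] {P : Type} [DecidableEq P] [Finite P]
    (T : TwoWaySystem α P) (hT : IsSemilinearSet T.good)
    (h : ∀ w π π', T.Run w (T.start, 0) π → visits π ∈ T.good →
      T.Run w (T.start, 0) π' → visits π' ∈ T.good → π = π') :
    IsWeaklyUnambiguousPALanguage T.accepts := by
  classical
  obtain ⟨d, ⟨e⟩⟩ := Finite.exists_equiv_fin (TapeSymbol α × Block P)
  let φ : (TapeSymbol α × Block P → ℕ) ≃+ (Fin d → ℕ) :=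
    (LinearEquiv.funCongrLeft ℕ ℕ e.symm).toAddEquiv
  have hd : 1 ≤ d := Nat.one_le_iff_ne_zero.2 fun h0 => by
    subst h0
    exact (e (.leftEnd, none, T.start, none)).elim0
  have hnil : ∀ π, (T.toParikhAutomaton hT φ).IsAcceptingRun [] π ↔ π = [] ∧ [] ∈ T.accepts := by
    intro π
    constructor
    · rintro ⟨⟨q, hq, hr⟩, hm, -⟩
      obtain rfl : π = [] := by simpa using hm
      cases hr
      exact ⟨rfl, hq⟩
    · rintro ⟨rfl, he⟩
      exact ⟨⟨none, he, .nil _⟩, rfl, 0, Or.inl rfl, by simp⟩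
  refine ⟨PAState P, inferInstance, d, hd, T.toParikhAutomaton hT φ, ?_, ?_⟩
  · intro w π π' h1 h2
    rcases eq_or_ne w [] with rfl | hw
    · rw [((hnil _).1 h1).1, ((hnil _).1 h2).1]
    · rw [isAcceptingRun_iff hw] at h1 h2
      obtain ⟨C, hC, ⟨v, hv, hCv⟩, rfl⟩ := h1
      obtain ⟨C', hC', ⟨v', hv', hCv'⟩, rfl⟩ := h2
      -- Each family of columns comes from some run of the system. The two runs coincide by
      -- hypothesis, and a run determines its columns.
      obtain ⟨π, h1, rfl, h3⟩ := hC.exists_run hCv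
      obtain ⟨π', h1', rfl, h3'⟩ := hC'.exists_run hCv'
      obtain rfl := h w π π' h1 hv h1' hv'
      obtain rfl : C = C' := by
        ext x b
        rw [h3, h3']
      rfl
  · ext w
    rcases eq_or_ne w [] with rfl | hw
    · constructor
      · rintro ⟨π, hπ⟩
        exact ((hnil _).1 hπ).2
      · exact fun h => ⟨[], (hnil _).2 ⟨rfl, h⟩⟩
    · constructor
      · rintro ⟨π, hπ⟩
        obtain ⟨C, hC, ⟨v, hv, hCv⟩, rfl⟩ := (isAcceptingRun_iff hw).1 hπ
        obtain ⟨π, h1, rfl, h3⟩ := hC.exists_run hCv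
        exact ⟨π, h1, hv⟩
      · rintro ⟨π, hπ, hv⟩
        obtain ⟨C, hC, hCv⟩ := hπ.exists_isColumns
        exact ⟨_, (isAcceptingRun_iff hw).2 ⟨C, hC, ⟨_, hv, hCv⟩, rfl⟩⟩

end TwoWaySystem

/-! ## Counter machines with phases -/

/-- The direction after a move: it changes only if the move goes in the other direction. -/
def newDir (b : Bool) : SignType → Bool
  | .zero => b
  | .neg => false
  | .pos => true

/-- A state of a counter machine together with the set of zero counters, the directions in which the
counters and the head have changed last, the number of times that these data have changed, the
last update of the counters, and whether these data have changed in the last step. -/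
@[ext]
structure PhaseState (Q : Type*) (k S : ℕ) where
  state : Q
  isZero : Fin k → Bool
  up : Fin k → Bool
  right : Bool
  phase : Fin (S + 1)
  update : Fin k → SignType
  fresh : Bool

namespace PhaseState

variable {Q : Type*} {k S : ℕ}

instance instFinite [Finite Q] : Finite (PhaseState Q k S) :=
  Finite.of_injective
    (fun p => (p.state, p.isZero, p.up, p.right, p.phase, p.update, p.fresh))
    fun p q h => by
      simp only [Prod.mk.injEq] at h
      ext1 <;> tauto

/-- The data that are constant during a phase. -/
def mode (p : PhaseState Q k S) : (Fin k → Bool) × (Fin k → Bool) × Bool :=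
  (p.isZero, p.up, p.right)

/-- The second state belongs to a new phase if and only if it has another mode than the first. -/
def Succ (p q : PhaseState Q k S) : Prop :=
  (p.mode = q.mode ∧ q.fresh = false ∧ (q.phase : ℕ) = p.phase) ∨
    (p.mode ≠ q.mode ∧ q.fresh = true ∧ (q.phase : ℕ) = p.phase + 1)

/-- The last update is compatible with the mode. -/
def Consistent (p : PhaseState Q k S) : Prop :=
  ∀ i, (p.up i = true → 0 ≤ (p.update i : ℤ)) ∧ (p.up i = false → (p.update i : ℤ) ≤ 0) ∧
    (p.fresh = false → p.isZero i = true → (p.update i : ℤ) = 0)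

end PhaseState

theorem isSemilinearSet_setOf_eq_zero {ι : Type*} [Finite ι] (f : (ι → ℕ) →+ ℤ) :
    IsSemilinearSet {v | f v = 0} := by
  simpa using isSemilinearSet_setOfPred_eq (0 : ℤ) 0 f (0 : (ι → ℕ) →+ ℤ)

/-- Positivity of `f v` means `f v = 1 + m` for some natural number `m`: the set is a projection of
the solutions of a linear equation. -/
theorem isSemilinearSet_setOf_pos {ι : Type*} [Finite ι] (f : (ι → ℕ) →+ ℤ) :
    IsSemilinearSet {v | 0 < f v} := by
  have h := isSemilinearSet_setOfPred_eq (0 : ℤ) 1 (f.comp (AddMonoidHom.fst (ι → ℕ) ℕ))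
    ((Nat.castAddMonoidHom ℤ).comp (AddMonoidHom.snd (ι → ℕ) ℕ))
  convert h.image (AddMonoidHom.fst (ι → ℕ) ℕ) using 1
  ext v
  constructor
  · intro hv
    obtain ⟨m, hm⟩ := Int.eq_ofNat_of_zero_le (show 0 ≤ f v - 1 from Int.sub_nonneg_of_le hv)
    refine ⟨(v, m), ?_, rfl⟩
    change 0 + f v = 1 + (m : ℤ)
    omega
  · rintro ⟨⟨v, m⟩, h, rfl⟩
    replace h : 0 + f v = 1 + (m : ℤ) := h
    change 0 < f v
    omega

/-! ### Correctness of the guessed zero counters as a condition on visits -/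

namespace PhaseState

variable {Q : Type*} {k S : ℕ}

/-- The updates of the counter `i` in the states of the list. -/
def listUpdate (i : Fin k) (l : List (PhaseState Q k S)) : ℤ :=
  (l.map fun p => (p.update i : ℤ)).sum

/-- The updates of the counter `i` until phase `s` begins. -/
def firstUpdate (s : ℕ) (i : Fin k) (l : List (PhaseState Q k S)) : ℤ :=
  listUpdate i (l.filter fun p => p.phase < s ∨ p.phase = s ∧ p.fresh)

/-- The updates of the counter `i` until phase `s` ends. -/
def lastUpdate (s : ℕ) (i : Fin k) (l : List (PhaseState Q k S)) : ℤ :=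
  listUpdate i (l.filter fun p => p.phase ≤ s)

/-- Starting with the counter values `κ` and making the updates of the given states, the values
of the counters are never negative, and the zero counters are those of the states. -/
def Valid (κ : Fin k → ℤ) : List (PhaseState Q k S) → Prop
  | [] => True
  | p :: l => (∀ i, 0 ≤ κ i + p.update i ∧ (κ i + p.update i = 0 ↔ p.isZero i = true)) ∧
      Valid (fun i => κ i + p.update i) l

theorem valid_iff {κ : Fin k → ℤ} {l : List (PhaseState Q k S)} :
    Valid κ l ↔ ∀ l₁ p l₂, l = l₁ ++ p :: l₂ → ∀ i,
      0 ≤ κ i + listUpdate i (l₁ ++ [p]) ∧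
        (κ i + listUpdate i (l₁ ++ [p]) = 0 ↔ p.isZero i = true) := by
  induction l generalizing κ with
  | nil => simp [Valid]
  | cons q l ih =>
    rw [Valid, ih]
    constructor
    · rintro ⟨h1, h2⟩ l₁ p l₂ h i
      rcases l₁ with _ | ⟨r, l₁⟩
      · simp only [List.nil_append, List.cons.injEq] at h
        obtain ⟨rfl, rfl⟩ := h
        simpa [listUpdate] using h1 i
      · simp only [List.cons_append, List.cons.injEq] at h
        obtain ⟨rfl, rfl⟩ := h
        simpa [listUpdate, add_assoc] using h2 l₁ p l₂ rfl i
    · intro h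
      refine ⟨fun i => by simpa [listUpdate] using h [] q l rfl i, ?_⟩
      rintro l₁ p l₂ rfl i
      simpa [listUpdate, add_assoc] using h (q :: l₁) p l₂ rfl i

theorem listUpdate_append (i : Fin k) (l l' : List (PhaseState Q k S)) :
    listUpdate i (l ++ l') = listUpdate i l + listUpdate i l' := by
  simp [listUpdate]

theorem listUpdate_filter_add (i : Fin k) (l : List (PhaseState Q k S))
    (F : PhaseState Q k S → Bool) :
    listUpdate i (l.filter F) + listUpdate i (l.filter fun p => !F p) = listUpdate i l := by
  induction l with
  | nil => simp [listUpdate]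
  | cons p l ih =>
    simp only [listUpdate] at ih ⊢
    rcases h : F p <;> simp [h, ← ih] <;> ring

section

variable {l : List (PhaseState Q k S)}

/-- The relation between any two states of a run. -/
def Later (p q : PhaseState Q k S) : Prop :=
  p.phase < q.phase ∨ p.phase = q.phase ∧ p.mode = q.mode ∧ q.fresh = false

theorem Succ.later {p q : PhaseState Q k S} (h : Succ p q) : Later p q := by
  rcases h with ⟨h1, h2, h3⟩ | ⟨h1, h2, h3⟩
  · exact Or.inr ⟨Fin.ext h3.symm, h1, h2⟩
  · exact Or.inl (Fin.lt_def.2 (by omega))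

instance : IsTrans (PhaseState Q k S) Later where
  trans p q r h h' := by
    rcases h with h | ⟨h1, h2, h3⟩ <;> rcases h' with h' | ⟨h1', h2', h3'⟩
    · exact Or.inl (h.trans h')
    · exact Or.inl (h1' ▸ h)
    · exact Or.inl (h1 ▸ h')
    · exact Or.inr ⟨h1.trans h1', h2.trans h2', h3'⟩

theorem pairwise_later (h : l.IsChain Succ) : l.Pairwise Later :=
  List.isChain_iff_pairwise.1 (h.imp fun _ _ => Succ.later)

theorem mode_eq (h : l.Pairwise Later) {p q : PhaseState Q k S} (hp : p ∈ l) (hq : q ∈ l)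
    (hpq : p.phase = q.phase) : p.mode = q.mode := by
  induction h with
  | nil => simp at hp
  | @cons r l h _ ih =>
    rcases List.mem_cons.1 hp with hp | hp <;> rcases List.mem_cons.1 hq with hq | hq
    · rw [hp, hq]
    · rcases h q hq with h | h
      · exact absurd (hp ▸ hpq) h.ne
      · exact hp ▸ h.2.1
    · rcases h p hp with h | h
      · exact absurd (hq ▸ hpq.symm) h.ne
      · exact hq ▸ h.2.1.symm
    · exact ih hp hq

theorem exists_first {p : PhaseState Q k S} (hp : p ∈ l) : ∃ l₁ q l₂, l = l₁ ++ q :: l₂ ∧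
    q.phase = p.phase ∧ ∀ r ∈ l₁, r.phase ≠ p.phase := by
  induction l with
  | nil => simp at hp
  | cons a l ih =>
    by_cases ha : a.phase = p.phase
    · exact ⟨[], a, l, rfl, ha, by simp⟩
    · rcases List.mem_cons.1 hp with rfl | hp
      · exact absurd rfl ha
      · obtain ⟨l₁, q, l₂, rfl, h2, h3⟩ := ih hp
        exact ⟨a :: l₁, q, l₂, rfl, h2, by simpa [ha] using h3⟩

theorem exists_last {p : PhaseState Q k S} (hp : p ∈ l) : ∃ l₁ q l₂, l = l₁ ++ q :: l₂ ∧
    q.phase = p.phase ∧ ∀ r ∈ l₂, r.phase ≠ p.phase := by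
  obtain ⟨l₁, q, l₂, h1, h2, h3⟩ := exists_first (List.mem_reverse.2 hp)
  refine ⟨l₂.reverse, q, l₁.reverse, ?_, h2, by simpa using h3⟩
  rw [← List.reverse_reverse l, h1]
  simp

/-- A state stores the update by which it was entered, so the update of the fresh state of a phase
is made before that phase begins. No state after `p` contributes to `firstUpdate`, since in the
phase of `p` only non-fresh states can follow. -/
theorem firstUpdate_eq {l₁ l₂ : List (PhaseState Q k S)} {p : PhaseState Q k S}
    (h : (l₁ ++ p :: l₂).Pairwise Later) (i : Fin k) :
    listUpdate i (l₁ ++ [p]) = firstUpdate p.phase i (l₁ ++ p :: l₂) +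
      listUpdate i ((l₁ ++ [p]).filter fun r => r.phase = p.phase ∧ r.fresh = false) := by
  rw [List.append_cons, List.pairwise_append] at h
  obtain ⟨h1, -, h2⟩ := h
  have hB : l₂.filter (fun r => decide ((r.phase : ℕ) < p.phase ∨
      (r.phase : ℕ) = p.phase ∧ r.fresh = true)) = [] := by
    rw [List.filter_eq_nil_iff]
    intro r hr
    rcases h2 p (by simp) r hr with h | ⟨h, -, h'⟩
    · have := Fin.lt_def.1 h
      simp only [decide_eq_true_eq]
      omega
    · simp [h, h']
  rw [firstUpdate, show l₁ ++ p :: l₂ = (l₁ ++ [p]) ++ l₂ by simp, List.filter_append, hB,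
    List.append_nil, ← listUpdate_filter_add i (l₁ ++ [p])
      fun r => decide ((r.phase : ℕ) < p.phase ∨ (r.phase : ℕ) = p.phase ∧ r.fresh = true)]
  · congr 2
    apply List.filter_congr
    intro r hr
    have hr : r.phase ≤ p.phase := by
      rcases List.mem_append.1 hr with hr | hr
      · rcases (List.pairwise_append.1 h1).2.2 r hr p (by simp) with h | h
        · exact h.le
        · exact h.1.le
      · rw [List.mem_singleton.1 hr]
    rw [Fin.le_def] at hr
    rw [Bool.eq_iff_iff]
    rcases hf : r.fresh <;> simp [Fin.ext_iff, -Fin.val_fin_lt, -Fin.val_fin_le] <;> omega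

theorem lastUpdate_eq {l₁ l₂ : List (PhaseState Q k S)} {p : PhaseState Q k S}
    (h : (l₁ ++ p :: l₂).Pairwise Later) (i : Fin k) :
    lastUpdate p.phase i (l₁ ++ p :: l₂) = listUpdate i (l₁ ++ [p]) +
      listUpdate i (l₂.filter fun r => r.phase = p.phase) := by
  rw [List.append_cons, List.pairwise_append] at h
  obtain ⟨h1, -, h2⟩ := h
  have hA : (l₁ ++ [p]).filter (fun r => decide ((r.phase : ℕ) ≤ p.phase)) = l₁ ++ [p] := by
    rw [List.filter_eq_self]
    intro r hr
    rcases List.mem_append.1 hr with hr | hr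
    · rcases (List.pairwise_append.1 h1).2.2 r hr p (by simp) with h | h
      · simpa using h.le
      · simpa using h.1.le
    · rw [List.mem_singleton.1 hr]
      simp
  rw [lastUpdate, show l₁ ++ p :: l₂ = (l₁ ++ [p]) ++ l₂ by simp, List.filter_append, hA,
    listUpdate_append]
  · congr 2
    apply List.filter_congr
    intro r hr
    have : p.phase ≤ r.phase := by
      rcases h2 p (by simp) r hr with h | h
      · exact h.le
      · exact h.1.le
    rw [Fin.le_def] at this
    simp [Fin.ext_iff]
    omega

theorem listUpdate_nonneg {i : Fin k} (h : ∀ p ∈ l, 0 ≤ (p.update i : ℤ)) : 0 ≤ listUpdate i l :=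
  List.sum_nonneg (by simpa using h)

theorem listUpdate_nonpos {i : Fin k} (h : ∀ p ∈ l, (p.update i : ℤ) ≤ 0) : listUpdate i l ≤ 0 := by
  induction l with
  | nil => simp [listUpdate]
  | cons p l ih =>
    have h1 := h p List.mem_cons_self
    have h2 := ih fun q hq => h q (List.mem_cons_of_mem _ hq)
    simp only [listUpdate, List.map_cons, List.sum_cons] at h2 ⊢
    omega

theorem listUpdate_eq_zero {i : Fin k} (h : ∀ p ∈ l, (p.update i : ℤ) = 0) : listUpdate i l = 0 :=
  le_antisymm (listUpdate_nonpos fun p hp => (h p hp).le) (listUpdate_nonneg fun p hp => (h p hp).ge)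

/-- The counters are valid if and only if they are so when each phase begins and ends. -/
theorem valid_zero_iff (hl : l.IsChain Succ) (hc : ∀ p ∈ l, p.Consistent)
    (hf : ∀ p ∈ l.head?, p.fresh = true) :
    Valid (fun _ => 0) l ↔ ∀ p ∈ l, ∀ i, (p.isZero i = true → firstUpdate p.phase i l = 0) ∧
      (p.isZero i = false → 0 < firstUpdate p.phase i l ∧ 0 < lastUpdate p.phase i l) := by
  have hpw := pairwise_later hl
  have hmode : ∀ {p q}, p ∈ l → q ∈ l → p.phase = q.phase → ∀ i, p.isZero i = q.isZero i ∧
      p.up i = q.up i := by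
    intro p q hp hq hpq i
    have := mode_eq hpw hp hq hpq
    simp only [mode, Prod.mk.injEq] at this
    rw [this.1, this.2.1]
    exact ⟨rfl, rfl⟩
  rw [valid_iff]
  simp only [zero_add]
  constructor
  · intro h p hp i
    have key : ∀ l₁ q l₂, l = l₁ ++ q :: l₂ → q.phase = p.phase →
        0 ≤ listUpdate i (l₁ ++ [q]) ∧
        (listUpdate i (l₁ ++ [q]) = 0 ↔ p.isZero i = true) := by
      intro l₁ q l₂ hq hqp
      rw [(hmode hp (show q ∈ l by rw [hq]; simp) hqp.symm i).1]
      exact h l₁ q l₂ hq i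
    obtain ⟨l₁, q, l₂, hq, hqp, hl₁⟩ := exists_first hp
    have h1 := key l₁ q l₂ hq hqp
    have h2 : listUpdate i (l₁ ++ [q]) = firstUpdate p.phase i l := by
      subst hq
      rw [firstUpdate_eq hpw, hqp, listUpdate_eq_zero, add_zero]
      intro r hr
      rw [List.mem_filter, List.mem_append, List.mem_singleton] at hr
      obtain ⟨hr | rfl, hr'⟩ := hr
      · simp only [decide_eq_true_eq] at hr'
        exact absurd hr'.1 (hl₁ r hr)
      · simp only [decide_eq_true_eq] at hr'
        -- The first state of a phase is fresh: it is the head of the list, or its predecessor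
        -- belongs to another phase.
        exfalso
        rcases List.eq_nil_or_concat l₁ with rfl | ⟨l', a, rfl⟩
        · simp [hr'] at hf
        · rw [List.concat_eq_append, List.append_assoc, List.singleton_append] at hl
          have h3 := (List.isChain_append_cons_cons.1 hl).2.1
          rcases h3 with ⟨-, -, h3⟩ | ⟨-, h3, -⟩
          · exact hl₁ a (by simp) ((Fin.ext h3.symm).trans hqp)
          · simp [hr'] at h3
    obtain ⟨m₁, q', m₂, hq', hqp', hm₂⟩ := exists_last hp
    have h1' := key m₁ q' m₂ hq' hqp'
    have h3 : lastUpdate p.phase i l = listUpdate i (m₁ ++ [q']) := by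
      subst hq'
      rw [← hqp', lastUpdate_eq hpw, List.filter_eq_nil_iff.2]
      · simp [listUpdate]
      · intro r hr
        simpa [hqp'] using hm₂ r hr
    rw [h2] at h1
    rw [← h3] at h1'
    refine ⟨h1.2.2, fun hz => ⟨lt_of_le_of_ne h1.1 fun h0 => ?_, lt_of_le_of_ne h1'.1 fun h0 => ?_⟩⟩
    · rw [h1.2.1 h0.symm] at hz
      cases hz
    · rw [h1'.2.1 h0.symm] at hz
      cases hz
  · rintro h l₁ p l₂ rfl i
    have hp : p ∈ l₁ ++ p :: l₂ := by simp
    obtain ⟨h1, h2⟩ := h p hp i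
    have h3 := firstUpdate_eq hpw i
    have h4 := lastUpdate_eq hpw i
    have hmem : ∀ r ∈ l₁ ++ [p], r ∈ l₁ ++ p :: l₂ := by
      intro r hr
      rw [List.append_cons]
      exact List.mem_append_left _ hr
    rcases hz : p.isZero i
    · have h5 : 0 < listUpdate i (l₁ ++ [p]) := by
        -- A counter that does not increase in this phase is at least its value at the end of the
        -- phase; one that does not decrease is at least its value at the beginning. Both bounds are
        -- positive.
        rcases hu : p.up i
        · have h6 := listUpdate_nonpos (i := i) (l := l₂.filter fun r => r.phase = p.phase) (by
            intro r hr
            rw [List.mem_filter, decide_eq_true_eq] at hr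
            have hr' : r ∈ l₁ ++ p :: l₂ := by simp [hr.1]
            exact (hc r hr' i).2.1 (by rw [(hmode hr' hp hr.2 i).2, hu]))
          have := (h2 hz).2
          omega
        · have h6 := listUpdate_nonneg (i := i)
            (l := (l₁ ++ [p]).filter fun r => r.phase = p.phase ∧ r.fresh = false) (by
            intro r hr
            rw [List.mem_filter, decide_eq_true_eq] at hr
            have hr' := hmem r hr.1
            exact (hc r hr' i).1 (by rw [(hmode hr' hp hr.2.1 i).2, hu]))
          have := (h2 hz).1
          omega
      exact ⟨h5.le, by simp [h5.ne']⟩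
    -- A counter that is zero in this phase does not change after the first state of the phase.
    · have h6 := listUpdate_eq_zero (i := i)
        (l := (l₁ ++ [p]).filter fun r => r.phase = p.phase ∧ r.fresh = false) (by
        intro r hr
        rw [List.mem_filter, decide_eq_true_eq] at hr
        have hr' := hmem r hr.1
        exact (hc r hr' i).2.2 hr.2.2 (by rw [(hmode hr' hp hr.2.1 i).1, hz]))
      have := h1 hz
      exact ⟨by omega, by simp; omega⟩

end

/-- The linear map that computes the updates of the counter `i` in the states satisfying `F` from the
numbers of occurrences of the states. -/
noncomputable def updateHom [Finite Q] (F : PhaseState Q k S → Bool) (i : Fin k) :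
    (PhaseState Q k S → ℕ) →+ ℤ :=
  letI := Fintype.ofFinite (PhaseState Q k S)
  ∑ p, (AddMonoidHom.mulLeft (if F p then (p.update i : ℤ) else 0)).comp
    ((Nat.castAddMonoidHom ℤ).comp (Pi.evalAddMonoidHom (fun _ => ℕ) p))

theorem updateHom_sum [Finite Q] [DecidableEq (PhaseState Q k S)] (F : PhaseState Q k S → Bool)
    (i : Fin k) (l : List (PhaseState Q k S)) :
    updateHom F i (l.map fun p => Pi.single p 1).sum = listUpdate i (l.filter F) := by
  have h1 : ∀ q, updateHom F i (Pi.single q 1) = if F q then (q.update i : ℤ) else 0 := by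
    intro q
    simp [updateHom, Pi.single_apply]
  induction l with
  | nil => simp [listUpdate]
  | cons p l ih =>
    rw [List.map_cons, List.sum_cons, map_add, ih, h1, List.filter_cons]
    split_ifs <;> simp [listUpdate]

/-- The numbers of visits of the states in runs with valid counters. -/
def goodVisits [Finite Q] : Set (PhaseState Q k S → ℕ) :=
  {v | ∀ (p : PhaseState Q k S) (i : Fin k), v p = 0 ∨
    (p.isZero i = true ∧
      updateHom (fun r => (r.phase : ℕ) < p.phase ∨ (r.phase : ℕ) = p.phase ∧ r.fresh) i v = 0) ∨
    (p.isZero i = false ∧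
      0 < updateHom (fun r => (r.phase : ℕ) < p.phase ∨ (r.phase : ℕ) = p.phase ∧ r.fresh) i v ∧
      0 < updateHom (fun r => (r.phase : ℕ) ≤ p.phase) i v)}

theorem isSemilinearSet_goodVisits [Finite Q] :
    IsSemilinearSet (goodVisits : Set (PhaseState Q k S → ℕ)) := by
  have h : (goodVisits : Set (PhaseState Q k S → ℕ)) = ⋂ (p : PhaseState Q k S) (i : Fin k),
      ({v | ((Nat.castAddMonoidHom ℤ).comp (Pi.evalAddMonoidHom (fun _ => ℕ) p)) v = 0} ∪
      ((if p.isZero i = true then Set.univ else ∅) ∩ {v | updateHom (fun r =>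
        (r.phase : ℕ) < p.phase ∨ (r.phase : ℕ) = p.phase ∧ r.fresh) i v = 0} ∪
      (if p.isZero i = false then Set.univ else ∅) ∩ ({v | 0 < updateHom (fun r =>
        (r.phase : ℕ) < p.phase ∨ (r.phase : ℕ) = p.phase ∧ r.fresh) i v} ∩
        {v | 0 < updateHom (fun r => (r.phase : ℕ) ≤ p.phase) i v}))) := by
    ext v
    simp only [goodVisits, Set.mem_iInter]
    refine forall_congr' fun p => forall_congr' fun i => ?_
    rcases p.isZero i <;> simp
  rw [h]
  refine .iInter fun p => .iInter fun i => (isSemilinearSet_setOf_eq_zero _).union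
    ((IsSemilinearSet.inter ?_ (isSemilinearSet_setOf_eq_zero _)).union
    (IsSemilinearSet.inter ?_ ((isSemilinearSet_setOf_pos _).inter (isSemilinearSet_setOf_pos _))))
  all_goals split_ifs
  all_goals simp

/-- The criterion `valid_zero_iff` mentions only which states occur and sums of updates over sets of
states, and both can be read off the visit vector. -/
theorem sum_mem_goodVisits_iff [Finite Q] [DecidableEq (PhaseState Q k S)]
    {l : List (PhaseState Q k S)} (hl : l.IsChain Succ) (hc : ∀ p ∈ l, p.Consistent)
    (hf : ∀ p ∈ l.head?, p.fresh = true) :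
    (l.map fun p => Pi.single p 1).sum ∈ goodVisits ↔ Valid (fun _ => 0) l := by
  have hv : ∀ p, (l.map fun p => (Pi.single p 1 : PhaseState Q k S → ℕ)).sum p = 0 ↔ p ∉ l := by
    intro p
    clear hl hc hf
    induction l with
    | nil => simp
    | cons q l ih =>
      by_cases h : p = q
      · simp [h]
      · simp [ih, h]
  rw [valid_zero_iff hl hc hf]
  simp only [goodVisits, Set.mem_ofPred_eq, updateHom_sum, hv, firstUpdate, lastUpdate]
  refine forall_congr' fun p => ?_
  by_cases hp : p ∈ l
  · simp only [hp, not_true, false_or, forall_true_left]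
    refine forall_congr' fun i => ?_
    rcases p.isZero i <;> simp
  · simp [hp]

end PhaseState

/-! ### Counting changes of direction -/

/-- The sign of the difference between successive numbers. -/
abbrev stepSign (x y : ℕ) : SignType := if x < y then 1 else if y < x then -1 else 0

theorem stepSign_eq {x y : ℕ} {u : SignType} (h : (y : ℤ) = (x : ℤ) + (u : ℤ)) : stepSign x y = u := by
  unfold stepSign
  rcases u with _ | _ | _
  · have : (y : ℤ) = x := by simpa using h
    rw [if_neg (by omega), if_neg (by omega)]
    rfl
  · have : (y : ℤ) = x + -1 := by simpa using h
    rw [if_neg (by omega), if_pos (by omega)]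
    rfl
  · have : (y : ℤ) = x + 1 := by simpa using h
    rw [if_pos (by omega)]
    rfl

/-- The number of changes of direction in a sequence, with initial direction `b`. -/
def dirChanges (b : Bool) : List ℕ → ℕ
  | [] => 0
  | [_] => 0
  | x :: y :: l => (if b = newDir b (stepSign x y) then 0 else 1) +
      dirChanges (newDir b (stepSign x y)) (y :: l)

/-- The number of changes between zero and non-zero values in a sequence. -/
def zeroChanges : List ℕ → ℕ
  | [] => 0
  | [_] => 0
  | x :: y :: l => (if x = 0 ↔ y = 0 then 0 else 1) + zeroChanges (y :: l)

/-- A counter leaves zero upwards and reaches it downwards, and these events alternate; so each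
change after the first needs a change of direction. The extra `1` is for a first change that already
agrees with the direction `b`. -/
theorem zeroChanges_le (b : Bool) (x : ℕ) (l : List ℕ) :
    zeroChanges (x :: l) ≤ dirChanges b (x :: l) + if (x = 0 ↔ b = true) then 1 else 0 := by
  induction l generalizing b x with
  | nil => simp [zeroChanges]
  | cons y l ih =>
    rw [zeroChanges, dirChanges]
    have h := ih (newDir b (stepSign x y)) y
    rcases lt_trichotomy x y with hxy | rfl | hxy
    · have h1 : newDir b (stepSign x y) = true := by rw [stepSign, if_pos hxy]; rfl
      rw [h1] at h ⊢
      have hy : y ≠ 0 := by omega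
      simp only [hy, if_false, iff_false, iff_true] at h ⊢
      rcases b <;> rcases Nat.eq_zero_or_pos x with rfl | hx <;> simp [*, Nat.pos_iff_ne_zero.1] <;>
        omega
    · have h1 : newDir b (stepSign x x) = b := by simp [stepSign]; rfl
      rw [h1] at h ⊢
      simpa using h
    · have h1 : newDir b (stepSign x y) = false := by
        rw [stepSign, if_neg hxy.not_gt, if_pos hxy]; rfl
      rw [h1] at h ⊢
      have hx : x ≠ 0 := by omega
      simp only [hx, false_iff, Bool.false_eq_true, iff_false] at h ⊢
      rcases b <;> rcases Nat.eq_zero_or_pos y with rfl | hy <;> simp at h ⊢ <;>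
        first | omega | (split_ifs at h ⊢ <;> omega)

/-- The nonzero signs of the successive differences of a sequence. -/
def nonzeroSigns (l : List ℕ) : List SignType :=
  (List.zipWith stepSign l l.tail).filter fun s => s ≠ 0

/-- The signs at which the direction changes alternate, and `destutter` produces an alternating
sublist of maximal length. The condition on the head, that the first of these signs opposes `b`,
carries the induction. -/
theorem exists_sublist_dirChanges (b : Bool) (l : List ℕ) :
    ∃ l' : List SignType, l'.Sublist (nonzeroSigns l) ∧ l'.IsChain (· ≠ ·) ∧
      l'.length = dirChanges b l ∧ ∀ s ∈ l'.head?, s ≠ if b then 1 else -1 := by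
  induction l generalizing b with
  | nil => exact ⟨[], by simp, by simp, rfl, by simp⟩
  | cons x l ih =>
    rcases l with _ | ⟨y, l⟩
    · exact ⟨[], by simp, by simp, rfl, by simp⟩
    · rw [dirChanges]
      have hs : (nonzeroSigns (y :: l)).Sublist (nonzeroSigns (x :: y :: l)) := by
        exact (List.sublist_cons_self (stepSign x y) (List.zipWith stepSign (y :: l) l)).filter _
      obtain ⟨l', h1, h2, h3, h4⟩ := ih (newDir b (stepSign x y))
      by_cases hb : b = newDir b (stepSign x y)
      · rw [if_pos hb]
        rw [← hb] at h3 h4 ⊢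
        exact ⟨l', h1.trans hs, h2, by simpa using h3, h4⟩
      · have key : ∀ (b : Bool) (s : SignType), b ≠ newDir b s →
            s = (if newDir b s then 1 else -1) ∧ s ≠ 0 ∧ s ≠ if b then 1 else -1 := by
          decide
        have hsign := key b _ hb
        rw [if_neg hb]
        refine ⟨stepSign x y :: l', ?_, ?_, ?_, ?_⟩
        · have : nonzeroSigns (x :: y :: l) = stepSign x y :: nonzeroSigns (y :: l) := by
            exact List.filter_cons_of_pos (by simpa using hsign.2.1)
          rw [this]
          exact h1.cons_cons _
        · refine h2.cons fun s hs => ?_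
          rw [hsign.1]
          exact (h4 s hs).symm
        · rw [List.length_cons, h3, add_comm]
        · simpa using hsign.2.2

theorem dirChanges_le (b : Bool) (l : List ℕ) : dirChanges b l ≤ numReversals l + 1 := by
  obtain ⟨l', h1, h2, h3, -⟩ := exists_sublist_dirChanges b l
  have := List.IsChain.length_le_length_destutter_ne h1 h2
  unfold numReversals
  rw [← h3]
  change _ ≤ ((nonzeroSigns l).destutter _).length - 1 + 1
  omega

namespace CounterMachine

variable {α Q : Type*} {k : ℕ}

/-- The zero counters of a configuration. -/
def zeros (c : CounterConfig Q k) : Fin k → Bool := fun i => decide (c.counter i = 0)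

/-- The directions of the counters after a step. -/
def nextUp (up : Fin k → Bool) (c c' : CounterConfig Q k) : Fin k → Bool :=
  fun i => newDir (up i) (stepSign (c.counter i) (c'.counter i))

/-- The number of changes of the mode in a computation. -/
def modeChanges : (Fin k → Bool) → Bool → List (CounterConfig Q k) → ℕ
  | _, _, [] => 0
  | _, _, [_] => 0
  | up, right, c :: c' :: π =>
    (if (zeros c, up, right) =
      (zeros c', nextUp up c c', newDir right (stepSign c.head c'.head)) then 0 else 1) +
    modeChanges (nextUp up c c') (newDir right (stepSign c.head c'.head)) (c' :: π)

theorem modeChanges_le_sum (up : Fin k → Bool) (right : Bool) (π : List (CounterConfig Q k)) :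
    modeChanges up right π ≤ ∑ i, (zeroChanges (π.map fun c => c.counter i) +
      dirChanges (up i) (π.map fun c => c.counter i)) + dirChanges right (π.map fun c => c.head) := by
  induction π generalizing up right with
  | nil => simp [modeChanges]
  | cons c π ih =>
    rcases π with _ | ⟨c', π⟩
    · simp [modeChanges]
    · rw [modeChanges]
      have h := ih (nextUp up c c') (newDir right (stepSign c.head c'.head))
      simp only [List.map_cons, zeroChanges, dirChanges] at h ⊢
      have h1 : ∀ i, newDir (up i) (stepSign (c.counter i) (c'.counter i)) = nextUp up c c' i :=
        fun _ => rfl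
      simp only [h1]
      have hm : (if (zeros c, up, right) = (zeros c', nextUp up c c',
          newDir right (stepSign c.head c'.head)) then 0 else 1) ≤
          ∑ i, ((if c.counter i = 0 ↔ c'.counter i = 0 then 0 else 1) +
            (if up i = nextUp up c c' i then 0 else 1)) +
          if right = newDir right (stepSign c.head c'.head) then 0 else 1 := by
        split_ifs with h2 h3 h3
        · simp
        · simp
        · rw [add_zero, Nat.one_le_iff_ne_zero]
          intro h4
          rw [Finset.sum_eq_zero_iff] at h4
          refine h2 (Prod.ext (funext fun i => ?_) (Prod.ext (funext fun i => ?_) h3))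
          · simpa [zeros] using (Nat.add_eq_zero_iff.1 (h4 i (Finset.mem_univ i))).1
          · simpa using (Nat.add_eq_zero_iff.1 (h4 i (Finset.mem_univ i))).2
        · omega
      simp only [Finset.sum_add_distrib] at hm h ⊢
      omega

/-- Each counter has at most `n + 1` changes of direction (the first may be due to the initial
direction) and hence at most `n + 2` changes between zero and non-zero; the head has at most `m + 1`
changes of direction. -/
theorem modeChanges_le {m n : ℕ} {right : Bool} {up : Fin k → Bool} {π : List (CounterConfig Q k)}
    (h : numReversals (π.map fun c => c.head) ≤ m ∧
      ∀ i, numReversals (π.map fun c => c.counter i) ≤ n) :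
    modeChanges up right π ≤ k * (2 * n + 3) + (m + 1) := by
  refine (modeChanges_le_sum up right π).trans (add_le_add ?_ ?_)
  · have h1 : ∀ i, zeroChanges (π.map fun c => c.counter i) +
        dirChanges (up i) (π.map fun c => c.counter i) ≤ 2 * n + 3 := by
      intro i
      have h2 := dirChanges_le (up i) (π.map fun c => c.counter i)
      have h3 := h.2 i
      have h4 : zeroChanges (π.map fun c => c.counter i) ≤
          dirChanges (up i) (π.map fun c => c.counter i) + 1 := by
        cases π with
        | nil => simp [zeroChanges]
        | cons c π =>
          refine (zeroChanges_le (up i) _ _).trans (Nat.add_le_add_left ?_ _)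
          split_ifs <;> simp
      omega
    simpa using Finset.sum_le_card_nsmul Finset.univ _ _ fun i _ => h1 i
  · exact (dirChanges_le _ _).trans (Nat.add_le_add_right h.1 1)

end CounterMachine

/-! ### From counter machines to Parikh automata -/

namespace CounterMachine

variable {α Q : Type*} {k : ℕ}

/-- The device without counters that simulates a counter machine for `S` phases by guessing the sets
of zero counters. -/
noncomputable def phaseSystem [Finite Q] (M : CounterMachine α Q k) (S : ℕ) :
    TwoWaySystem α (PhaseState Q k S) where
  start := ⟨M.start, fun _ => true, fun _ => true, true, 0, fun _ => 0, true⟩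
  trans a p d q := ∃ t ∈ M.trans, t.source = p.state ∧ t.symbol = a ∧ t.isZero = p.isZero ∧
    t.target = q.state ∧ t.move = d ∧ t.update = q.update ∧
    -- For a counter that was zero the update determines the next guess, so it is constant during a
    -- phase in which it stays zero. The guesses for the other counters are left free here; `good`
    -- checks them.
    (∀ i, p.isZero i = true → (q.isZero i = true ↔ q.update i = 0)) ∧
    (∀ i, q.up i = newDir (p.up i) (q.update i)) ∧ q.right = newDir p.right d ∧ p.Succ q
  -- Halting means that each transition enabled by state, symbol and zero counters is blocked, by
  -- decrementing a zero counter or by leaving the tape.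
  halt a p := p.state ∈ M.final ∧ ∀ t ∈ M.trans, t.source = p.state → t.symbol = a →
    t.isZero = p.isZero → (∃ i, p.isZero i = true ∧ t.update i = -1) ∨
      (a = .leftEnd ∧ t.move = -1) ∨ (a = .rightEnd ∧ t.move = 1)
  phase p := p.phase
  goesRight p := p.right
  good := PhaseState.goodVisits
  phase_le := by
    rintro a p d q ⟨t, -, -, -, -, -, -, -, -, -, -, h | h⟩ <;> omega
  goesRight_eq := by
    rintro a p d q ⟨t, -, -, -, -, -, -, -, -, -, -, h | h⟩ hpq
    · exact congrArg (fun x => x.2.2) h.1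
    · omega
  move_eq := by
    rintro a p d q ⟨t, -, -, -, -, -, -, -, -, -, hr, h | h⟩ hpq hd
    · have h1 : p.right = q.right := congrArg (fun x => x.2.2) h.1
      rw [← h1] at hr
      revert hr hd
      generalize p.right = b
      revert b d
      decide
    · omega

variable {S : ℕ} {w : List α}

/-- The configurations of the counter machine in a run of the phase system. -/
def confs (κ : Fin k → ℤ) : List (PhaseState Q k S × ℕ) → List (CounterConfig Q k)
  | [] => []
  | c :: π => ⟨c.1.state, c.2, fun i => (κ i + c.1.update i).toNat⟩ ::
      confs (fun i => κ i + c.1.update i) π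

theorem tapeSymbolAt_eq_leftEnd_iff {x : ℕ} : tapeSymbolAt w x = .leftEnd ↔ x = 0 := by
  cases x with
  | zero => simp [tapeSymbolAt]
  | succ x =>
    simp only [tapeSymbolAt]
    split <;> simp

theorem tapeSymbolAt_eq_rightEnd_iff {x : ℕ} :
    tapeSymbolAt w x = .rightEnd ↔ w.length + 1 ≤ x := by
  cases x with
  | zero => simp [tapeSymbolAt]
  | succ x =>
    simp only [tapeSymbolAt]
    split
    · rename_i h
      simpa using (List.getElem?_eq_some_iff.1 h).1
    · rename_i h
      simpa using h

theorem signType_cases (u : SignType) :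
    u = 0 ∧ (u : ℤ) = 0 ∨ u = -1 ∧ (u : ℤ) = -1 ∨ u = 1 ∧ (u : ℤ) = 1 := by
  revert u
  decide

variable [Finite Q] {M : CounterMachine α Q k}

theorem isChain_confs {c : PhaseState Q k S × ℕ} {π : List (PhaseState Q k S × ℕ)}
    (h : (M.phaseSystem S).Run w c π) {κ : Fin k → ℤ} (hv : PhaseState.Valid κ (π.map Prod.fst)) :
    (confs κ π).IsChain (M.Step w) ∧
      ∃ e, (confs κ π).getLast? = some e ∧ e.state ∈ M.final ∧ ∀ e', ¬ M.Step w e e' := by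
  induction h generalizing κ with
  | @halt c h =>
    refine ⟨by simp [confs], ⟨c.1.state, c.2, fun i => (κ i + c.1.update i).toNat⟩, rfl, h.1, ?_⟩
    rintro e' ⟨t, ht, h1, h2, h3, -, h5, h6, h7⟩
    have hz : t.isZero = c.1.isZero := by
      funext i
      have hi := hv.1 i
      rw [Bool.eq_iff_iff, h3, ← hi.2]
      exact Int.toNat_eq_zero.trans ⟨fun h => le_antisymm h hi.1, fun h => h.le⟩
    rcases h.2 t ht h1 h2 hz with ⟨i, hi, hu⟩ | ⟨ha, hm⟩ | ⟨ha, hm⟩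
    · have := h7 i
      rw [hu, (h3 i).1 (by rw [hz, hi])] at this
      simp at this
    · rw [tapeSymbolAt_eq_leftEnd_iff] at ha
      rw [hm] at h5
      simp [ha] at h5
    · rw [tapeSymbolAt_eq_rightEnd_iff] at ha
      rw [hm] at h5
      simp at h5 h6
      omega
  | @step c c' π hs h ih =>
    obtain ⟨π', rfl⟩ := h.eq_cons
    obtain ⟨hv, hv'⟩ := hv
    obtain ⟨ih, e, he⟩ := ih hv'
    refine ⟨.cons_cons ?_ ih, e, by simpa [confs] using he⟩
    obtain ⟨d, ⟨t, ht, h1, h2, h3, h4, h5, h6, h7, h8, h9, h10⟩, hd, hc'⟩ := hs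
    refine ⟨t, ht, h1, h2, fun i => ?_, h4.symm, by rw [h5]; exact hd, hc', fun i => ?_⟩
    · have hi := hv i
      rw [h3, ← hi.2]
      simp only
      omega
    · have hi := hv i
      have hi' := hv'.1 i
      rw [h6, Int.toNat_of_nonneg hi.1, Int.toNat_of_nonneg hi'.1]

/-- Valid counters are non-negative, so `toNat` loses nothing and successive configurations
determine the updates and the move. From these and the previous state follow the zero counters, the
directions, and thereby the phase and `fresh`. -/
theorem confs_injective {c : PhaseState Q k S × ℕ} {π π' : List (PhaseState Q k S × ℕ)}
    (h : (M.phaseSystem S).Run w c π) (h' : (M.phaseSystem S).Run w c π') {κ : Fin k → ℤ}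
    (hv : PhaseState.Valid κ (π.map Prod.fst)) (hv' : PhaseState.Valid κ (π'.map Prod.fst))
    (he : confs κ π = confs κ π') : π = π' := by
  induction h generalizing κ π' with
  | halt h =>
    cases h' with
    | halt h' => rfl
    | step hs h' =>
      obtain ⟨π'', rfl⟩ := h'.eq_cons
      simp [confs] at he
  | @step c c' π hs h ih =>
    cases h' with
    | halt h' =>
      obtain ⟨π'', rfl⟩ := h.eq_cons
      simp [confs] at he
    | @step _ c'' π' hs' h' =>
      have hcc : c' = c'' := by
        obtain ⟨π₁, rfl⟩ := h.eq_cons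
        obtain ⟨π₂, rfl⟩ := h'.eq_cons
        simp only [confs, List.cons.injEq, CounterConfig.mk.injEq] at he
        obtain ⟨-, ⟨h1, h2, h3⟩, -⟩ := he
        have hv1 := hv.2.1
        have hv2 := hv'.2.1
        obtain ⟨d, ⟨t, -, -, -, -, -, -, -, -, h8, h9, h10⟩, hd, -⟩ := hs
        obtain ⟨d', ⟨t', -, -, -, -, -, -, -, -, h8', h9', h10'⟩, hd', -⟩ := hs'
        have hu : c'.1.update = c''.1.update := by
          funext i
          have h4 := congrFun h3 i
          have h5 : 0 ≤ κ i + c.1.update i + c'.1.update i := (hv1 i).1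
          have h6 : 0 ≤ κ i + c.1.update i + c''.1.update i := (hv2 i).1
          rw [← TwoWaySystem.sign_intCast (c'.1.update i),
            ← TwoWaySystem.sign_intCast (c''.1.update i)]
          congr 1
          omega
        have hz : c'.1.isZero = c''.1.isZero := by
          funext i
          rw [Bool.eq_iff_iff, ← (hv1 i).2, ← (hv2 i).2, hu]
        have hup : c'.1.up = c''.1.up := by
          funext i
          rw [h8, h8', hu]
        have hdd : d = d' := by
          rw [← TwoWaySystem.sign_intCast d, ← TwoWaySystem.sign_intCast d']
          congr 1
          omega
        have hr : c'.1.right = c''.1.right := by rw [h9, h9', hdd]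
        have hm : c'.1.mode = c''.1.mode := by simp only [PhaseState.mode, hz, hup, hr]
        have hpf : (c'.1.phase : ℕ) = c''.1.phase ∧ c'.1.fresh = c''.1.fresh := by
          rcases h10 with h | h <;> rcases h10' with h' | h'
          · exact ⟨by omega, by rw [h.2.1, h'.2.1]⟩
          · exact absurd (h.1.trans hm) h'.1
          · exact absurd (h'.1.trans hm.symm) h.1
          · exact ⟨by omega, by rw [h.2.1, h'.2.1]⟩
        exact Prod.ext (PhaseState.ext h1 hz hup hr (Fin.ext hpf.1) hu hpf.2) h2
      subst hcc
      simp only [confs, List.cons.injEq] at he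
      rw [ih h' hv.2 hv'.2 he.2]

/-- The guesses are computed from the computation itself. By `hS`, the phases still available
suffice for the mode changes to come. -/
theorem exists_run {e : CounterConfig Q k} {π : List (CounterConfig Q k)}
    (hπ : (e :: π).IsChain (M.Step w))
    (hl : ∃ c, (e :: π).getLast? = some c ∧ c.state ∈ M.final ∧ ∀ c', ¬ M.Step w c c')
    {p : PhaseState Q k S} {κ : Fin k → ℤ} (hs : p.state = e.state) (hz : p.isZero = zeros e)
    (hκ : ∀ i, κ i + p.update i = e.counter i) (he : e.head ≤ w.length + 1)
    (hS : p.phase + modeChanges p.up p.right (e :: π) ≤ S) :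
    ∃ π', (M.phaseSystem S).Run w (p, e.head) π' ∧ PhaseState.Valid κ (π'.map Prod.fst) ∧
      confs κ π' = e :: π := by
  have hv : ∀ i, 0 ≤ κ i + p.update i ∧ (κ i + p.update i = 0 ↔ p.isZero i = true) := by
    intro i
    rw [hκ, hz]
    simp [zeros]
  have hc : (⟨p.state, e.head, fun i => (κ i + p.update i).toNat⟩ : CounterConfig Q k) = e := by
    simp [hκ, hs]
  induction π generalizing e p κ with
  | nil =>
    simp only [List.getLast?_singleton, Option.some.injEq, exists_eq_left'] at hl
    refine ⟨[(p, e.head)], .halt ⟨?_, fun t ht h1 h2 h3 => ?_⟩, ⟨hv, trivial⟩, by simpa [confs] using hc⟩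
    · simpa [hs] using hl.1
    · by_contra! hcon
      obtain ⟨hc1, hc2, hc3⟩ := hcon
      have hm : 0 ≤ (e.head : ℤ) + t.move ∧ (e.head : ℤ) + t.move ≤ w.length + 1 := by
        simp only at hc2 hc3
        rw [tapeSymbolAt_eq_leftEnd_iff] at hc2
        rw [tapeSymbolAt_eq_rightEnd_iff] at hc3
        rcases signType_cases t.move with h | h | h
        · omega
        · have : e.head ≠ 0 := fun h' => hc2 h' h.1
          omega
        · have : ¬ w.length + 1 ≤ e.head := fun h' => hc3 h' h.1
          omega
      have hu : ∀ i, 0 ≤ (e.counter i : ℤ) + t.update i := by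
        intro i
        have h4 := hc1 i
        simp only [hz, zeros, decide_eq_true_eq] at h4
        rcases signType_cases (t.update i) with h | h | h
        · omega
        · have : e.counter i ≠ 0 := fun h' => h4 h' h.1
          omega
        · omega
      refine hl.2 ⟨t.target, ((e.head : ℤ) + t.move).toNat,
        fun i => ((e.counter i : ℤ) + t.update i).toNat⟩ ⟨t, ht, by rw [h1, hs], h2, ?_, rfl,
        Int.toNat_of_nonneg hm.1, ?_, fun i => Int.toNat_of_nonneg (hu i)⟩
      · intro i
        rw [h3, hz]
        simp [zeros]
      · exact (Int.toNat_le (n := w.length + 1)).2 (by exact_mod_cast hm.2)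
  | cons e' π ih =>
    obtain ⟨⟨t, ht, h1, h2, h3, h4, h5, h6, h7⟩, hπ'⟩ := List.isChain_cons_cons.1 hπ
    rw [modeChanges] at hS
    have hzt : t.isZero = p.isZero := by
      funext i
      rw [Bool.eq_iff_iff, h3, hz]
      simp [zeros]
    have hmv := stepSign_eq h5
    have hup : ∀ i, nextUp p.up e e' i = newDir (p.up i) (t.update i) := fun i => by
      rw [nextUp, stepSign_eq (h7 i)]
    classical
    -- Whether the mode changes in this step: this is the flag `fresh` of the next state and also
    -- the increment of its phase.
    set b : Bool := decide ((zeros e, p.up, p.right) ≠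
      (zeros e', nextUp p.up e e', newDir p.right (stepSign e.head e'.head))) with hb
    have hb' : (if (zeros e, p.up, p.right) =
      (zeros e', nextUp p.up e e', newDir p.right (stepSign e.head e'.head)) then 0 else 1) =
        b.toNat := by
      rw [hb]
      split_ifs with h <;> simp [h]
    rw [hb'] at hS
    let q : PhaseState Q k S := ⟨e'.state, zeros e', nextUp p.up e e',
      newDir p.right (stepSign e.head e'.head), ⟨p.phase + b.toNat, by omega⟩, t.update, b⟩
    have hq : ∀ i, κ i + p.update i + q.update i = e'.counter i := fun i => by
      rw [hκ, h7]
    obtain ⟨π', h8, h9, h10⟩ := ih hπ' (by simpa using hl) (p := q)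
      (κ := fun i => κ i + p.update i) rfl rfl hq h6 (by simp only [q]; omega)
      (fun i => by rw [hq]; simp [q, zeros]) (by simp only [hq]; rfl)
    refine ⟨(p, e.head) :: π', .step ⟨t.move, ⟨t, ht, by rw [h1, hs], h2, hzt, h4.symm, rfl, rfl,
      fun i hi => ?_, hup, by rw [← hmv], ?_⟩, h5, h6⟩ h8, ⟨hv, h9⟩, by simp only [confs, h10, hc]⟩
    · have h11 := h7 i
      rw [hz] at hi
      simp only [zeros, decide_eq_true_eq] at hi
      simp only [q, zeros, decide_eq_true_eq]
      rw [hi] at h11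
      constructor
      · intro h0
        exact TwoWaySystem.eq_zero_of_intCast (by omega)
      · intro h0
        rw [h0] at h11
        simpa using h11
    · have hpm : p.mode = (zeros e, p.up, p.right) := by rw [PhaseState.mode, hz]
      have hqm : q.mode = (zeros e', nextUp p.up e e', newDir p.right (stepSign e.head e'.head)) :=
        rfl
      rw [PhaseState.Succ, hpm, hqm]
      rcases hbb : b
      · exact Or.inl ⟨of_not_not (by simpa only [hbb, decide_eq_false_iff_not] using hb.symm), by simp [q, hbb],
          by simp [q, hbb]⟩
      · exact Or.inr ⟨by simpa only [hbb, decide_eq_true_eq] using hb.symm, by simp [q, hbb], by simp [q, hbb]⟩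

theorem run_succ {c : PhaseState Q k S × ℕ} {π : List (PhaseState Q k S × ℕ)}
    (h : (M.phaseSystem S).Run w c π) (hc : c.1.Consistent) :
    (π.map Prod.fst).IsChain PhaseState.Succ ∧ ∀ p ∈ π.map Prod.fst, p.Consistent := by
  induction h with
  | halt h => simpa using hc
  | @step c c' π hs h ih =>
    obtain ⟨d, ⟨t, -, -, -, -, -, -, -, h7, h8, h9, h10⟩, -⟩ := hs
    have hc' : c'.1.Consistent := by
      intro i
      have key : ∀ (b : Bool) (s : SignType), (newDir b s = true → 0 ≤ (s : ℤ)) ∧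
        (newDir b s = false → (s : ℤ) ≤ 0) := by decide
      refine ⟨fun hu => (key _ _).1 ((h8 i).symm.trans hu),
        fun hu => (key _ _).2 ((h8 i).symm.trans hu), fun hf hz => ?_⟩
      rcases h10 with h | h
      · have hzz : c.1.isZero = c'.1.isZero := congrArg (fun x => x.1) h.1
        rw [(h7 i (by rw [hzz, hz])).1 hz]
        rfl
      · simp [hf] at h
    obtain ⟨ih1, ih2⟩ := ih hc'
    obtain ⟨π', rfl⟩ := h.eq_cons
    refine ⟨.cons_cons h10 ih1, ?_⟩
    intro p hp
    rcases List.mem_cons.1 hp with rfl | hp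
    · exact hc
    · exact ih2 p hp

theorem visits_mem_good_iff [DecidableEq (PhaseState Q k S)] {π : List (PhaseState Q k S × ℕ)}
    (h : (M.phaseSystem S).Run w ((M.phaseSystem S).start, 0) π) :
    TwoWaySystem.visits π ∈ (M.phaseSystem S).good ↔
      PhaseState.Valid (fun _ => 0) (π.map Prod.fst) := by
  have hc : (M.phaseSystem S).start.Consistent := fun i => by simp [phaseSystem]
  obtain ⟨h1, h2⟩ := run_succ h hc
  rw [← PhaseState.sum_mem_goodVisits_iff h1 h2]
  · simp [TwoWaySystem.visits, phaseSystem, Function.comp_def]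
  · obtain ⟨π', rfl⟩ := h.eq_cons
    simp [phaseSystem]

theorem head_confs_start {π : List (PhaseState Q k S × ℕ)}
    (h : (M.phaseSystem S).Run w ((M.phaseSystem S).start, 0) π) :
    (confs (fun _ => 0) π).head? = some M.initial := by
  obtain ⟨π', rfl⟩ := h.eq_cons
  simp [confs, phaseSystem, initial]

end CounterMachine

/-- With the number of phases given by `modeChanges_le`, the map `confs` is a bijection from the
good runs of the phase system onto the accepting computations, so unambiguity is preserved. -/
theorem IsUnambiguousRBCMLanguage.isWeaklyUnambiguousPALanguage {α : Type*} [Finite α]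
    {L : Language α} (h : IsUnambiguousRBCMLanguage L) : IsWeaklyUnambiguousPALanguage L := by
  classical
  obtain ⟨Q, _, k, M, ⟨m, n, hM⟩, hU, rfl⟩ := h
  have acc : ∀ {w π}, (M.phaseSystem (k * (2 * n + 3) + (m + 1))).Run w
      ((M.phaseSystem _).start, 0) π →
      TwoWaySystem.visits π ∈ (M.phaseSystem (k * (2 * n + 3) + (m + 1))).good →
      M.IsAcceptingComputation w (CounterMachine.confs (fun _ => 0) π) := by
    intro w π h1 h2
    rw [CounterMachine.visits_mem_good_iff h1] at h2
    obtain ⟨h3, h4⟩ := CounterMachine.isChain_confs h1 h2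
    exact ⟨⟨CounterMachine.head_confs_start h1, h3⟩, h4⟩
  have key := (M.phaseSystem (k * (2 * n + 3) + (m + 1))).isWeaklyUnambiguousPALanguage
    PhaseState.isSemilinearSet_goodVisits fun w π π' h1 h2 h3 h4 =>
      CounterMachine.confs_injective h1 h3 ((CounterMachine.visits_mem_good_iff h1).1 h2)
        ((CounterMachine.visits_mem_good_iff h3).1 h4) (hU w _ _ (acc h1 h2) (acc h3 h4))
  convert key using 1
  ext w
  constructor
  · rintro ⟨π, ⟨h1, h2⟩, h3⟩
    have hr := hM w π ⟨h1, h2⟩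
    rcases π with _ | ⟨e, π⟩
    · simp at h1
    · simp only [List.head?_cons, Option.some.injEq] at h1
      subst h1
      obtain ⟨π', h4, h5, h6⟩ := CounterMachine.exists_run
        (S := k * (2 * n + 3) + (m + 1)) h2 h3 (p := (M.phaseSystem _).start)
        (κ := fun _ => 0) rfl (by ext; simp [CounterMachine.phaseSystem, CounterMachine.zeros,
          CounterMachine.initial])
        (by simp [CounterMachine.phaseSystem, CounterMachine.initial])
        (by simp [CounterMachine.initial])
        (by simpa [CounterMachine.phaseSystem] using CounterMachine.modeChanges_le hr)
      exact ⟨π', h4, (CounterMachine.visits_mem_good_iff h4).2 h5⟩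
  · rintro ⟨π, h1, h2⟩
    exact ⟨_, acc h1 h2⟩

/-! ### From Parikh automata to counter machines -/

/-- A finite automaton with transitions `J`. A run yields an element of `R`, to which each transition
contributes its residue, and for each `t : T` a pair of natural numbers, to which each transition
and the beginning of the run (described by `none`) contribute their weights. Whether the run is
accepting depends on the element of `R` and on the comparison between the members of each pair. -/
structure ComparisonAutomaton (α Q J R T : Type*) where
  source : J → Q
  letter : J → α
  target : Option J → Q
  final : Set Q
  residue : J → R
  weight : Option J → T × Bool → ℕ
  good : R → (T → Bool) → Prop

/-- The states of a counter machine that simulates a comparison automaton: it adds the weights of a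
transition to the counters, or it compares the counters, or it has accepted. -/
inductive ComparisonState (J R : Type*) (B : ℕ)
  | add (j : Option J) (n : Fin (B + 1)) (ρ : R)
  | check (ρ : R)
  | acc

instance ComparisonState.instFinite {J R : Type*} {B : ℕ} [Finite J] [Finite R] :
    Finite (ComparisonState J R B) :=
  Finite.of_surjective
    (fun x : (Option J × Fin (B + 1) × R) ⊕ Option R => match x with
      | .inl (j, n, ρ) => ComparisonState.add j n ρ
      | .inr (some ρ) => .check ρ
      | .inr none => .acc)
    fun
      | .add j n ρ => ⟨.inl (j, n, ρ), rfl⟩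
      | .check ρ => ⟨.inr (some ρ), rfl⟩
      | .acc => ⟨.inr none, rfl⟩

namespace ComparisonAutomaton

variable {α Q J R T : Type*} (A : ComparisonAutomaton α Q J R T)

/-- A sequence of transitions that can follow the given one and that leads to a final state. -/
def Path : Option J → List J → Prop
  | j, [] => A.target j ∈ A.final
  | j, i :: l => A.source i = A.target j ∧ Path (some i) l

/-- The weights of a sequence of transitions. -/
def weights (l : List J) (c : T × Bool) : ℕ :=
  (l.map fun i => A.weight (some i) c).sum

/-- The comparison of the two members of each pair. -/
def comparison (f : T × Bool → ℕ) (t : T) : Bool := decide (f (t, false) ≤ f (t, true))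

/-- The accepting sequences of transitions. -/
def Accepts [AddMonoid R] (l : List J) : Prop :=
  A.Path none l ∧
    A.good (l.map A.residue).sum (comparison fun c => A.weight none c + A.weights l c)

/-- The symbol that is read by a transition. -/
def symbol : Option J → TapeSymbol α
  | none => .leftEnd
  | some i => .letter (A.letter i)

variable {k : ℕ} (σ : Fin k ≃ T × Bool) (B : ℕ)

/-- The transitions of the simulating counter machine. -/
inductive IsTransition [Add R] : CounterTransition α (ComparisonState J R B) k → Prop
  | increment (j : Option J) (n n' : Fin (B + 1)) (ρ : R) (z : Fin k → Bool) :
      (n' : ℕ) = n + 1 → IsTransition ⟨.add j n ρ, A.symbol j, z, .add j n' ρ, 0,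
        fun c => if n < A.weight j (σ c) then 1 else 0⟩
  | next (j : Option J) (i : J) (ρ : R) (z : Fin k → Bool) : A.source i = A.target j →
      IsTransition ⟨.add j (Fin.last B) ρ, A.symbol j, z, .add (some i) 0 (ρ + A.residue i), 1,
        fun _ => 0⟩
  | finish (j : Option J) (ρ : R) (z : Fin k → Bool) : A.target j ∈ A.final →
      IsTransition ⟨.add j (Fin.last B) ρ, A.symbol j, z, .check ρ, 1, fun _ => 0⟩
  | cancel (ρ : R) (z : Fin k → Bool) (t : T) : (∀ b, z (σ.symm (t, b)) = false) →
      IsTransition ⟨.check ρ, .rightEnd, z, .check ρ, 0,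
        fun c => if ∀ b, z (σ.symm ((σ c).1, b)) = false then -1 else 0⟩
  | accept (ρ : R) (z : Fin k → Bool) : (∀ t, ∃ b, z (σ.symm (t, b)) = true) →
      A.good ρ (fun t => z (σ.symm (t, false))) →
      IsTransition ⟨.check ρ, .rightEnd, z, .acc, 0, fun _ => 0⟩

/-- The simulating counter machine. -/
def machine [AddMonoid R] : CounterMachine α (ComparisonState J R B) k where
  start := .add none 0 0
  final := {.acc}
  trans := {t | A.IsTransition σ B t}

/-- The steps of the simulating counter machine. -/
inductive Next [Add R] (w : List α) : CounterConfig (ComparisonState J R B) k →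
    CounterConfig (ComparisonState J R B) k → Prop
  | increment {j : Option J} {n n' : Fin (B + 1)} {ρ : R} {x : ℕ} {f : Fin k → ℕ} :
      (n' : ℕ) = n + 1 → tapeSymbolAt w x = A.symbol j → x ≤ w.length + 1 →
      Next w ⟨.add j n ρ, x, f⟩
        ⟨.add j n' ρ, x, fun c => f c + if n < A.weight j (σ c) then 1 else 0⟩
  | next {j : Option J} {i : J} {ρ : R} {x : ℕ} {f : Fin k → ℕ} :
      A.source i = A.target j → tapeSymbolAt w x = A.symbol j → x + 1 ≤ w.length + 1 →
      Next w ⟨.add j (Fin.last B) ρ, x, f⟩ ⟨.add (some i) 0 (ρ + A.residue i), x + 1, f⟩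
  | finish {j : Option J} {ρ : R} {x : ℕ} {f : Fin k → ℕ} :
      A.target j ∈ A.final → tapeSymbolAt w x = A.symbol j → x + 1 ≤ w.length + 1 →
      Next w ⟨.add j (Fin.last B) ρ, x, f⟩ ⟨.check ρ, x + 1, f⟩
  | cancel {ρ : R} {x : ℕ} {f : Fin k → ℕ} (t : T) : (∀ b, f (σ.symm (t, b)) ≠ 0) →
      tapeSymbolAt w x = .rightEnd → x ≤ w.length + 1 →
      Next w ⟨.check ρ, x, f⟩
        ⟨.check ρ, x, fun c => if ∀ b, f (σ.symm ((σ c).1, b)) ≠ 0 then f c - 1 else f c⟩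
  | accept {ρ : R} {x : ℕ} {f : Fin k → ℕ} : (∀ t, ∃ b, f (σ.symm (t, b)) = 0) →
      A.good ρ (comparison (f ∘ σ.symm)) →
      tapeSymbolAt w x = .rightEnd → x ≤ w.length + 1 →
      Next w ⟨.check ρ, x, f⟩ ⟨.acc, x, f⟩

/-- Once a member of each pair is zero, the comparison can be read off the zero tests, which is all
that the machine sees. -/
theorem comparison_eq {f : T × Bool → ℕ} (h : ∀ t, ∃ b, f (t, b) = 0) (t : T) :
    comparison f t = decide (f (t, false) = 0) := by
  unfold comparison
  rcases h t with ⟨_ | _, h⟩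
  · simp [h]
  · simp [h]

theorem step_machine [AddMonoid R] (w : List α) : (A.machine σ B).Step w = A.Next σ B w := by
  ext ⟨p, x, f⟩ ⟨p', x', f'⟩
  constructor
  · rintro ⟨t, ht, h1, h2, h3, h4, h5, h6, h7⟩
    have hz : t.isZero = fun i => decide (f i = 0) := by
      funext i
      rw [Bool.eq_iff_iff, h3]
      simp
    have hz' : ∀ i, t.isZero i = decide (f i = 0) := congrFun hz
    clear h3 hz
    simp only at *
    rcases ht with ⟨j, n, n', ρ, z, hn⟩ | ⟨j, i, ρ, z, hs⟩ | ⟨j, ρ, z, hF⟩ | ⟨ρ, z, t, hb⟩ |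
      ⟨ρ, z, hb, hg⟩ <;> simp only at * <;> subst h1 h4
    · obtain rfl : x' = x := by simpa using h5
      obtain rfl : f' = fun c => f c + if n < A.weight j (σ c) then 1 else 0 := by
        funext c
        have := h7 c
        split_ifs at this ⊢ <;> simp at this <;> omega
      exact .increment hn h2.symm h6
    · obtain rfl : x' = x + 1 := by simp at h5; omega
      obtain rfl : f' = f := by
        funext c
        simpa using h7 c
      exact .next hs h2.symm h6
    · obtain rfl : x' = x + 1 := by simp at h5; omega
      obtain rfl : f' = f := by
        funext c
        simpa using h7 c
      exact .finish hF h2.symm h6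
    · obtain rfl : x' = x := by simpa using h5
      simp only [hz', decide_eq_false_iff_not] at hb h7
      obtain rfl : f' = fun c => if ∀ b, f (σ.symm ((σ c).1, b)) ≠ 0 then f c - 1 else f c := by
        funext c
        have := h7 c
        split_ifs at this with h
        · rw [if_pos h]
          simp at this
          omega
        · rw [if_neg h]
          simpa using this
      exact .cancel t hb h2.symm h6
    · obtain rfl : x' = x := by simpa using h5
      obtain rfl : f' = f := by
        funext c
        simpa using h7 c
      simp only [hz', decide_eq_true_eq] at hb hg
      refine .accept hb ?_ h2.symm h6
      rwa [show comparison (f' ∘ σ.symm) = _ from funext (comparison_eq hb)]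
  · intro h
    rcases h with ⟨hn, h2, h6⟩ | ⟨hs, h2, h6⟩ | ⟨hF, h2, h6⟩ | ⟨t, hb, h2, h6⟩ | ⟨hb, hg, h2, h6⟩
    · refine ⟨_, .increment _ _ _ _ (fun i => decide (f i = 0)) hn, rfl, h2.symm, by simp, rfl,
        by simp, h6, fun c => ?_⟩
      simp only
      split_ifs <;> simp
    · exact ⟨_, .next _ _ _ (fun i => decide (f i = 0)) hs, rfl, h2.symm, by simp, rfl,
        by simp, h6, fun c => by simp⟩
    · exact ⟨_, .finish _ _ (fun i => decide (f i = 0)) hF, rfl, h2.symm, by simp, rfl,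
        by simp, h6, fun c => by simp⟩
    · refine ⟨_, .cancel _ (fun i => decide (f i = 0)) t (by simpa using hb), rfl, h2.symm,
        by simp, rfl, by simp, h6, fun c => ?_⟩
      simp only [decide_eq_false_iff_not]
      split_ifs with h
      · have := h (σ c).2
        simp at this ⊢
        omega
      · simp
    · refine ⟨_, .accept _ (fun i => decide (f i = 0)) (by simpa using hb) ?_, rfl, h2.symm,
        by simp, rfl, by simp, h6, fun c => by simp⟩
      rwa [show comparison (f ∘ σ.symm) = _ from funext (comparison_eq hb)] at hg

end ComparisonAutomaton

/-! ### Accepting computations correspond to accepting sequences of transitions -/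

namespace ComparisonAutomaton

variable {α Q J R T : Type*} {A : ComparisonAutomaton α Q J R T} [AddMonoid R] {k : ℕ}
  {σ : Fin k ≃ T × Bool} {B : ℕ} {w : List α}

/-- A sequence of configurations that ends in an accepting one. -/
def Ends (π : List (CounterConfig (ComparisonState J R B) k)) : Prop :=
  ∃ e, π.getLast? = some e ∧ e.state = .acc

/-- The transitions that are chosen in a computation. -/
def choices : List (CounterConfig (ComparisonState J R B) k) → List J
  | [] => []
  | e :: π => match e.state with
    | .add (some i) n _ => if n = 0 then i :: choices π else choices π
    | _ => choices π

theorem not_next_acc {e e' : CounterConfig (ComparisonState J R B) k} (h : e.state = .acc) :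
    ¬ A.Next σ B w e e' := by
  rintro (_ | _ | _ | _ | _) <;> cases h

theorem eq_nil_of_acc {e : CounterConfig (ComparisonState J R B) k} {π}
    (hπ : (e :: π).IsChain (A.Next σ B w)) (h : e.state = .acc) : π = [] := by
  cases π with
  | nil => rfl
  | cons e' π => exact absurd (List.isChain_cons_cons.1 hπ).1 (not_next_acc h)

theorem comparison_cancel (f : Fin k → ℕ) :
    comparison ((fun c => if ∀ b, f (σ.symm ((σ c).1, b)) ≠ 0 then f c - 1 else f c) ∘ σ.symm) =
      comparison (f ∘ σ.symm) := by
  funext t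
  simp only [comparison, Function.comp_apply, Equiv.apply_symm_apply, Bool.forall_bool]
  rw [decide_eq_decide]
  split_ifs with hh
  · omega
  · rfl

theorem of_check {ρ : R} {x : ℕ} {f : Fin k → ℕ} {π}
    (hπ : (⟨.check ρ, x, f⟩ :: π).IsChain (A.Next σ B w)) (h : Ends (⟨.check ρ, x, f⟩ :: π)) :
    tapeSymbolAt w x = .rightEnd ∧ choices π = [] ∧ A.good ρ (comparison (f ∘ σ.symm)) := by
  induction π generalizing f with
  | nil =>
    obtain ⟨e, h, he⟩ := h
    simp only [List.getLast?_singleton, Option.some.injEq] at h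
    subst h
    cases he
  | cons e π ih =>
    obtain ⟨h1, h2⟩ := List.isChain_cons_cons.1 hπ
    have h' : Ends (e :: π) := by simpa [Ends] using h
    cases h1 with
    | cancel t hb hx hl =>
      obtain ⟨-, h4, h5⟩ := ih h2 h'
      refine ⟨hx, h4, ?_⟩
      rwa [comparison_cancel] at h5
    | accept hb hg hx hl =>
      obtain rfl := eq_nil_of_acc h2 rfl
      exact ⟨hx, rfl, hg⟩

/-- The counters, the rest of the weights of the current transition and the weights of the future
choices add up to the final values, which every step preserves. The bound `B` guarantees that no
rest is left when `n = B`. -/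
theorem of_add {j : Option J} {n : Fin (B + 1)} {ρ : R} {x : ℕ} {f : Fin k → ℕ} {π}
    (hB : ∀ c, A.weight j c ≤ B ∧ ∀ i, A.weight (some i) c ≤ B)
    (hπ : (⟨.add j n ρ, x, f⟩ :: π).IsChain (A.Next σ B w)) (h : Ends (⟨.add j n ρ, x, f⟩ :: π)) :
    tapeSymbolAt w x = A.symbol j ∧ A.Path j (choices π) ∧
      (choices π).map A.letter = w.drop x ∧
      A.good (ρ + ((choices π).map A.residue).sum)
        (comparison fun c => f (σ.symm c) + (A.weight j c - n) + A.weights (choices π) c) := by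
  induction π generalizing j n ρ x f with
  | nil =>
    obtain ⟨e, h, he⟩ := h
    simp only [List.getLast?_singleton, Option.some.injEq] at h
    subst h
    cases he
  | cons e π ih =>
    obtain ⟨h1, h2⟩ := List.isChain_cons_cons.1 hπ
    have h' : Ends (e :: π) := by simpa [Ends] using h
    cases h1 with
    | @increment _ _ n' _ _ _ hn hx hl =>
      obtain ⟨-, h4, h5, h6⟩ := ih hB h2 h'
      have hc : choices (⟨.add j n' ρ, x, fun c => f c + if n < A.weight j (σ c) then 1 else 0⟩ :: π)
          = choices π := by
        rw [choices]
        cases j with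
        | none => rfl
        -- A transition is recorded by `choices` only at `n = 0`, when it is entered, so it is
        -- recorded once.
        | some i => exact if_neg fun h => by simp [h] at hn
      rw [hc]
      refine ⟨hx, h4, h5, ?_⟩
      convert h6 using 3 with c
      simp only [Equiv.apply_symm_apply]
      split_ifs with hh <;> omega
    | @next _ i _ _ _ hs hx hl =>
      obtain ⟨h3, h4, h5, h6⟩ := ih (fun c => ⟨(hB c).2 i, (hB c).2⟩) h2 h'
      have hc : choices (⟨.add (some i) 0 (ρ + A.residue i), x + 1, f⟩ :: π) = i :: choices π := by
        simp [choices]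
      rw [hc]
      refine ⟨hx, ⟨hs, h4⟩, ?_, ?_⟩
      · simp only [tapeSymbolAt, symbol] at h3
        have h7 : w[x]? = some (A.letter i) := by
          rcases hw : w[x]? with _ | a
          · simp [hw] at h3
          · simpa [hw] using h3
        obtain ⟨h8, h9⟩ := List.getElem?_eq_some_iff.1 h7
        rw [List.drop_eq_getElem_cons h8, h9, List.map_cons, h5]
      · convert h6 using 1
        · simp [add_assoc]
        · congr 1
          funext c
          have := (hB c).1
          simp [weights]
          omega
    | finish hF hx hl =>
      obtain ⟨h3, h4, h5⟩ := of_check h2 h'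
      have hc : choices (⟨.check ρ, x + 1, f⟩ :: π) = choices π := rfl
      rw [hc, h4]
      refine ⟨hx, hF, ?_, ?_⟩
      · rw [CounterMachine.tapeSymbolAt_eq_rightEnd_iff] at h3
        rw [List.drop_eq_nil_of_le (by omega)]
        rfl
      · convert h5 using 1
        · simp
        · congr 1
          funext c
          have := (hB c).1
          simp [weights]
          omega

/-- Only the steps after all weights have been added involve a choice, namely of the next transition
or of finishing; finishing leaves no further choices. In the checking state all pairs of non-zero
counters are decreased together, so the result of a `cancel` step does not depend on the witness
`t`, and `accept` requires that no such pair exists. -/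
theorem eq_of_choices_eq {e : CounterConfig (ComparisonState J R B) k} {π π'}
    (hπ : (e :: π).IsChain (A.Next σ B w)) (h : Ends (e :: π))
    (hπ' : (e :: π').IsChain (A.Next σ B w)) (h' : Ends (e :: π'))
    (hc : choices π = choices π') : π = π' := by
  induction π generalizing e π' with
  | nil =>
    obtain ⟨e', he, ha⟩ := h
    simp only [List.getLast?_singleton, Option.some.injEq] at he
    subst he
    exact (eq_nil_of_acc hπ' ha).symm
  | cons e₁ π ih =>
    cases π' with
    | nil =>
      obtain ⟨e', he, ha⟩ := h'
      simp only [List.getLast?_singleton, Option.some.injEq] at he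
      subst he
      exact eq_nil_of_acc hπ ha
    | cons e₂ π' =>
      obtain ⟨h1, h2⟩ := List.isChain_cons_cons.1 hπ
      obtain ⟨h1', h2'⟩ := List.isChain_cons_cons.1 hπ'
      have h3 : Ends (e₁ :: π) := by simpa [Ends] using h
      have h3' : Ends (e₂ :: π') := by simpa [Ends] using h'
      suffices he : e₁ = e₂ ∧ choices π = choices π' by
        obtain ⟨rfl, hcc⟩ := he
        rw [ih h2 h3 h2' h3' hcc]
      cases h1 with
      | @increment j n n' ρ x f hn hx hl =>
        cases h1' with
        | @increment _ _ n'' _ _ _ hn' hx' hl' =>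
          obtain rfl : n' = n'' := Fin.ext (hn.trans hn'.symm)
          refine ⟨rfl, ?_⟩
          rcases j with _ | i
          · exact hc
          · have h0 : n' ≠ 0 := fun h => by simp [h] at hn
            simpa [choices, h0] using hc
        | next => have := n'.2; simp at hn; omega
        | finish => have := n'.2; simp at hn; omega
      | @next j i ρ x f hs hx hl =>
        cases h1' with
        | @increment _ _ n'' _ _ _ hn' hx' hl' => have := n''.2; simp at hn'; omega
        | @next _ i' _ _ _ hs' hx' hl' =>
          simp only [choices, if_true, List.cons.injEq] at hc
          obtain ⟨rfl, hc⟩ := hc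
          exact ⟨rfl, hc⟩
        | finish hs' hx' hl' =>
          have := (of_check h2' h3').2.1
          simp only [choices, if_true, this] at hc
          cases hc
      | @finish j ρ x f hs hx hl =>
        cases h1' with
        | @increment _ _ n'' _ _ _ hn' hx' hl' => have := n''.2; simp at hn'; omega
        | @next _ i' _ _ _ hs' hx' hl' =>
          have := (of_check h2 h3).2.1
          simp only [choices, if_true, this] at hc
          cases hc
        | finish hs' hx' hl' => exact ⟨rfl, hc⟩
      | @cancel ρ x f t hb hx hl =>
        cases h1' with
        | cancel t' hb' hx' hl' => exact ⟨rfl, hc⟩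
        | accept hb' =>
          obtain ⟨b, hb'⟩ := hb' t
          exact absurd hb' (hb b)
      | accept hb hg hx hl =>
        cases h1' with
        | cancel t' hb' hx' hl' =>
          obtain ⟨b, hb⟩ := hb t'
          exact absurd hb (hb' b)
        | accept hb' => exact ⟨rfl, hc⟩

/-- An accepting configuration can be reached. -/
def Reaches (A : ComparisonAutomaton α Q J R T) (σ : Fin k ≃ T × Bool) (B : ℕ) (w : List α)
    (e : CounterConfig (ComparisonState J R B) k) : Prop :=
  ∃ e', Relation.ReflTransGen (A.Next σ B w) e e' ∧ e'.state = .acc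

theorem Reaches.of_next {e e' : CounterConfig (ComparisonState J R B) k}
    (h : A.Next σ B w e e') (h' : Reaches A σ B w e') : Reaches A σ B w e := by
  obtain ⟨e'', h1, h2⟩ := h'
  exact ⟨e'', .head h h1, h2⟩

/-- The number `N` bounds the smaller member of every pair, and each `cancel` step lowers this bound
by one. -/
theorem reaches_check {ρ : R} {x : ℕ} {f : Fin k → ℕ} {N : ℕ}
    (hN : ∀ t, ∃ b, f (σ.symm (t, b)) ≤ N)
    (hx : tapeSymbolAt w x = .rightEnd) (hl : x ≤ w.length + 1)
    (hg : A.good ρ (comparison (f ∘ σ.symm))) : Reaches A σ B w ⟨.check ρ, x, f⟩ := by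
  induction N generalizing f with
  | zero => exact .of_next (.accept (by simpa using hN) hg hx hl) ⟨_, .refl, rfl⟩
  | succ N ih =>
    by_cases h : ∀ t, ∃ b, f (σ.symm (t, b)) = 0
    · exact .of_next (.accept h hg hx hl) ⟨_, .refl, rfl⟩
    · push Not at h
      obtain ⟨t, ht⟩ := h
      refine .of_next (.cancel t ht hx hl) (ih (fun t => ?_) ?_)
      · simp only [Equiv.apply_symm_apply]
        split_ifs with hh
        · obtain ⟨b, hb⟩ := hN t
          exact ⟨b, by omega⟩
        · push Not at hh
          obtain ⟨b, hb⟩ := hh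
          exact ⟨b, by omega⟩
      · rwa [comparison_cancel]

/-- Weights are added in unit steps numbered from `0` to `B - 1`, where step `n` increases the
counters of weight greater than `n`. As `B` bounds the weights, each counter has received its full
weight at the end. -/
theorem reaches_of_last {j : Option J} {n : Fin (B + 1)} {ρ : R} {x : ℕ} {f : Fin k → ℕ}
    (hB : ∀ c, A.weight j c ≤ B) (hx : tapeSymbolAt w x = A.symbol j) (hl : x ≤ w.length + 1)
    (h : Reaches A σ B w ⟨.add j (Fin.last B) ρ, x, fun c => f c + (A.weight j (σ c) - n)⟩) :
    Reaches A σ B w ⟨.add j n ρ, x, f⟩ := by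
  obtain ⟨m, hm⟩ : ∃ m, (n : ℕ) + m = B := ⟨B - n, by omega⟩
  induction m generalizing n f with
  | zero =>
    obtain rfl : n = Fin.last B := Fin.ext hm
    convert h using 2
    funext c
    have := hB (σ c)
    simp
    omega
  | succ m ih =>
    refine .of_next (.increment (n' := ⟨n + 1, by omega⟩) rfl hx hl) (ih ?_ (by simp only; omega))
    convert h using 3 with c
    simp only
    split_ifs with hh <;> omega

theorem reaches_add {l : List J} {j : Option J} {n : Fin (B + 1)} {ρ : R} {x : ℕ} {f : Fin k → ℕ}
    (hB : ∀ c, A.weight j c ≤ B ∧ ∀ i, A.weight (some i) c ≤ B)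
    (hx : tapeSymbolAt w x = A.symbol j) (hxl : x ≤ w.length) (hp : A.Path j l)
    (hl : l.map A.letter = w.drop x)
    (hg : A.good (ρ + (l.map A.residue).sum)
        (comparison fun c => f (σ.symm c) + (A.weight j c - n) + A.weights l c)) :
    Reaches A σ B w ⟨.add j n ρ, x, f⟩ := by
  refine reaches_of_last (fun c => (hB c).1) hx (by omega) ?_
  induction l generalizing j n ρ x f with
  | nil =>
    have hx' : w.length ≤ x := List.drop_eq_nil_iff.1 hl.symm
    refine .of_next (.finish hp hx (by omega)) (reaches_check
      -- Any bound will do; the sum of all counters bounds each of them.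
      (N := ∑ c, (f c + (A.weight j (σ c) - n))) (fun t => ⟨true, ?_⟩)
      (CounterMachine.tapeSymbolAt_eq_rightEnd_iff.2 (by omega)) (by omega) ?_)
    · exact Finset.single_le_sum_of_canonicallyOrdered
        (f := fun c => f c + (A.weight j (σ c) - n)) (Finset.mem_univ _)
    · simpa [weights, Function.comp_def] using hg
  | cons i l ih =>
    have hx' : x < w.length := by
      by_contra! h
      rw [List.drop_eq_nil_of_le h] at hl
      cases hl
    rw [List.drop_eq_getElem_cons hx', List.map_cons, List.cons.injEq] at hl
    have hs : tapeSymbolAt w (x + 1) = A.symbol (some i) := by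
      simp [tapeSymbolAt, symbol, hx', hl.1]
    refine .of_next (.next hp.1 hx (by omega)) (reaches_of_last (fun c => (hB c).2 i) hs (by omega)
      (ih (fun c => ⟨(hB c).2 i, (hB c).2⟩) hs hx' hp.2 hl.2 ?_))
    simpa [weights, add_assoc] using hg

end ComparisonAutomaton

/-! ### The simulating machine is reversal-bounded -/

theorem numReversals_le_two {l : List ℕ} (h : (nonzeroSigns l).Pairwise (· ≥ ·)) :
    numReversals l ≤ 2 := by
  unfold numReversals
  change ((nonzeroSigns l).destutter (· ≠ ·)).length - 1 ≤ 2
  have h1 := h.sublist (List.destutter_sublist (· ≠ ·) (nonzeroSigns l))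
  have h2 : ((nonzeroSigns l).destutter (· ≠ ·)).IsChain (· ≠ ·) := List.isChain_destutter _ _
  have h3 : ((nonzeroSigns l).destutter (· ≠ ·)).IsChain (· > ·) :=
    List.isChain_iff_getElem.2 fun i hi => lt_of_le_of_ne
      (List.isChain_iff_getElem.1 h1.isChain i hi) (List.isChain_iff_getElem.1 h2 i hi).symm
  have h4 : ((nonzeroSigns l).destutter (· ≠ ·)).Nodup :=
    (List.isChain_iff_pairwise.1 h3).imp fun h => h.ne'
  -- A strictly decreasing list of signs has no repetition and thus at most three members; this
  -- crude bound suffices.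
  have := h4.length_le_card
  have : Fintype.card SignType = 3 := rfl
  omega

theorem nonzeroSigns_cons (x y : ℕ) (l : List ℕ) : nonzeroSigns (x :: y :: l) =
    if stepSign x y = 0 then nonzeroSigns (y :: l) else stepSign x y :: nonzeroSigns (y :: l) := by
  unfold nonzeroSigns
  simp only [List.tail_cons, List.zipWith_cons_cons, List.filter_cons]
  split_ifs with h1 h2 h2
  · simp [h2] at h1
  · rfl
  · rfl
  · simp [h2] at h1

namespace ComparisonAutomaton

variable {α Q J R T : Type*} {A : ComparisonAutomaton α Q J R T} [AddMonoid R] {k : ℕ}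
  {σ : Fin k ≃ T × Bool} {B : ℕ} {w : List α}

theorem nonzeroSigns_head {π : List (CounterConfig (ComparisonState J R B) k)}
    (hπ : π.IsChain (A.Next σ B w)) : ∀ s ∈ nonzeroSigns (π.map fun e => e.head), s = 1 := by
  induction π with
  | nil => simp [nonzeroSigns]
  | cons e π ih =>
    rcases π with _ | ⟨e', π⟩
    · simp [nonzeroSigns]
    · obtain ⟨h1, h2⟩ := List.isChain_cons_cons.1 hπ
      specialize ih h2
      simp only [List.map_cons] at ih ⊢
      rw [nonzeroSigns_cons]
      split_ifs with h
      · exact ih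
      · refine List.forall_mem_cons.2 ⟨?_, ih⟩
        cases h1 <;> simp_all [stepSign]

/-- Counters grow only in `add` states and shrink only in `check` states, and the machine never
returns to an `add` state. The second part, on computations past the `add` states, is needed for the
induction. -/
theorem nonzeroSigns_counter {π : List (CounterConfig (ComparisonState J R B) k)}
    (hπ : π.IsChain (A.Next σ B w)) (c : Fin k) :
    (nonzeroSigns (π.map fun e => e.counter c)).Pairwise (· ≥ ·) ∧
      ((∀ e ∈ π.head?, ∀ j n ρ, e.state ≠ .add j n ρ) →
        ∀ s ∈ nonzeroSigns (π.map fun e => e.counter c), s = -1) := by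
  induction π with
  | nil => simp [nonzeroSigns]
  | cons e π ih =>
    rcases π with _ | ⟨e', π⟩
    · simp [nonzeroSigns]
    · obtain ⟨h1, h2⟩ := List.isChain_cons_cons.1 hπ
      obtain ⟨ih1, ih2⟩ := ih h2
      simp only [List.map_cons, List.head?_cons, Option.mem_some_iff, forall_eq'] at ih1 ih2 ⊢
      have hs : (stepSign (e.counter c) (e'.counter c) = 0 ∨
          stepSign (e.counter c) (e'.counter c) = 1 ∧ ∃ j n ρ, e.state = .add j n ρ) ∨
          stepSign (e.counter c) (e'.counter c) = -1 ∧ ∀ j n ρ, e'.state ≠ .add j n ρ := by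
        cases h1 with
        | increment => left; simp only [stepSign]; split_ifs <;> simp_all
        | next => simp [stepSign]
        | finish => simp [stepSign]
        | @cancel ρ x f =>
          simp only
          by_cases h : (∀ b, f (σ.symm ((σ c).1, b)) ≠ 0)
          · have := h (σ c).2
            simp at this
            right
            rw [if_pos h, stepSign, if_neg (by omega), if_pos (by omega)]
            simp
          · rw [if_neg h]
            simp [stepSign]
        | accept => simp [stepSign]
      have he : (∀ j n ρ, e.state ≠ .add j n ρ) → ∀ j n ρ, e'.state ≠ .add j n ρ := by
        intro h
        cases h1 <;> simp_all
      rw [nonzeroSigns_cons]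
      split_ifs with h
      · exact ⟨ih1, fun hh => ih2 (he hh)⟩
      · rcases hs with (hs | ⟨hs, j, n, ρ, hj⟩) | ⟨hs, he'⟩
        · exact absurd hs h
        · rw [hs]
          refine ⟨List.pairwise_cons.2 ⟨?_, ih1⟩, fun hh => absurd hj (hh j n ρ)⟩
          exact fun s _ => (by decide : ∀ s : SignType, 1 ≥ s) s
        · rw [hs]
          refine ⟨List.pairwise_cons.2 ⟨?_, ih1⟩, fun hh => List.forall_mem_cons.2 ⟨rfl, ih2 he'⟩⟩
          intro s hs'
          rw [ih2 he' s hs']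

theorem isReversalBounded_machine : (A.machine σ B).IsReversalBounded 2 2 := by
  rintro w π ⟨-, h⟩
  rw [step_machine] at h
  refine ⟨numReversals_le_two (List.pairwise_of_forall_mem_list ?_),
    fun c => numReversals_le_two (nonzeroSigns_counter h c).1⟩
  intro a ha b hb
  rw [nonzeroSigns_head h a ha, nonzeroSigns_head h b hb]

theorem isAcceptingComputation_iff {π : List (CounterConfig (ComparisonState J R B) k)} :
    (A.machine σ B).IsAcceptingComputation w π ↔
      π.head? = some (A.machine σ B).initial ∧ π.IsChain (A.Next σ B w) ∧ Ends π := by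
  rw [CounterMachine.IsAcceptingComputation, CounterMachine.IsComputation, step_machine, and_assoc]
  refine and_congr_right fun _ => and_congr_right fun _ => exists_congr fun e =>
    and_congr_right fun _ => ⟨fun h => h.1, fun h => ⟨h, fun _ => not_next_acc h⟩⟩

theorem accepts_choices (hB : ∀ j c, A.weight j c ≤ B) {π}
    (h : (A.machine σ B).IsAcceptingComputation w ((A.machine σ B).initial :: π)) :
    A.Accepts (choices π) ∧ (choices π).map A.letter = w := by
  rw [isAcceptingComputation_iff] at h
  obtain ⟨-, h1, h2, h3⟩ := of_add (fun c => ⟨hB _ c, fun i => hB _ c⟩) h.2.1 h.2.2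
  exact ⟨⟨h1, by simpa using h3⟩, by simpa using h2⟩

theorem exists_isAcceptingComputation (hB : ∀ j c, A.weight j c ≤ B) {l : List J}
    (h : A.Accepts l) :
    ∃ π, (A.machine σ B).IsAcceptingComputation (l.map A.letter) π := by
  obtain ⟨e, h1, h2⟩ := reaches_add (σ := σ) (w := l.map A.letter) (n := (0 : Fin (B + 1)))
    (ρ := 0) (x := 0) (f := fun _ => 0) (fun c => ⟨hB none c, fun i => hB _ c⟩) rfl (by simp) h.1
    rfl (by simpa using h.2)
  obtain ⟨π, h3, h4⟩ := List.exists_isChain_cons_of_relationReflTransGen h1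
  refine ⟨_ :: π, isAcceptingComputation_iff.2 ⟨rfl, h3, e, ?_, h2⟩⟩
  rw [List.getLast?_eq_some_getLast (List.cons_ne_nil _ _)]
  exact congrArg some h4

end ComparisonAutomaton

/-- The language of a comparison automaton that is unambiguous is accepted by an unambiguous
reversal-bounded counter machine. -/
theorem ComparisonAutomaton.isUnambiguousRBCMLanguage {α Q : Type*} {J R T : Type} [Finite J]
    [Finite R] [Finite T] [AddMonoid R] (A : ComparisonAutomaton α Q J R T)
    (hA : ∀ l l', A.Accepts l → A.Accepts l' → l.map A.letter = l'.map A.letter → l = l') :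
    IsUnambiguousRBCMLanguage {w | ∃ l, A.Accepts l ∧ l.map A.letter = w} := by
  obtain ⟨k, ⟨σ⟩⟩ := Finite.exists_equiv_fin (T × Bool)
  obtain ⟨B, hB⟩ := (Set.finite_range fun x : Option J × (T × Bool) => A.weight x.1 x.2).bddAbove
  replace hB : ∀ j c, A.weight j c ≤ B := fun j c => hB ⟨(j, c), rfl⟩
  refine ⟨ComparisonState J R B, inferInstance, k, A.machine σ.symm B,
    ⟨2, 2, isReversalBounded_machine⟩, fun w π π' h h' => ?_, ?_⟩
  · have h1 := isAcceptingComputation_iff.1 h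
    have h1' := isAcceptingComputation_iff.1 h'
    obtain ⟨_, rfl⟩ : ∃ l, π = _ :: l := ⟨_, List.eq_cons_of_mem_head? h1.1⟩
    obtain ⟨_, rfl⟩ : ∃ l, π' = _ :: l := ⟨_, List.eq_cons_of_mem_head? h1'.1⟩
    obtain ⟨h2, h3⟩ := accepts_choices hB h
    obtain ⟨h2', h3'⟩ := accepts_choices hB h'
    rw [eq_of_choices_eq h1.2.1 h1.2.2 h1'.2.1 h1'.2.2 (hA _ _ h2 h2' (h3.trans h3'.symm))]
  · ext w
    constructor
    · rintro ⟨π, h⟩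
      obtain ⟨_, rfl⟩ : ∃ l, π = _ :: l :=
        ⟨_, List.eq_cons_of_mem_head? (isAcceptingComputation_iff.1 h).1⟩
      exact ⟨_, accepts_choices hB h⟩
    · rintro ⟨l, h, rfl⟩
      exact exists_isAcceptingComputation hB h

/-! ### Parikh automata as comparison automata -/

namespace ParikhAutomaton

variable {α Q J : Type*} {d : ℕ} (A : ParikhAutomaton α Q d)

/-- The comparison automaton that simulates a Parikh automaton whose transitions are enumerated by
`e` and whose constraint depends on the residues modulo `m` and on the linear inequalities in `F`. -/
def comparisonAutomaton (e : J → Q × (α × (Fin d → ℕ)) × Q) (m : ℕ)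
    (F : Finset ((Fin d → ℤ) × ℤ)) : ComparisonAutomaton α Q J (Fin d → ZMod m) F where
  source i := (e i).1
  letter i := (e i).2.1.1
  target
    | none => A.start
    | some i => (e i).2.2
  final := A.final
  residue i x := ((e i).2.1.2 x : ZMod m)
  weight
    | none, (t, true) => t.1.2.toNat
    | none, (t, false) => (-t.1.2).toNat
    | some i, (t, true) => ∑ x, (t.1.1 x).toNat * (e i).2.1.2 x
    | some i, (t, false) => ∑ x, (-t.1.1 x).toNat * (e i).2.1.2 x
  good ρ p := ∃ v ∈ A.constraint, (∀ x, (v x : ZMod m) = ρ x) ∧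
    ∀ t : F, p t = true ↔ 0 ≤ t.1.2 + ∑ x, t.1.1 x * (v x : ℤ)

variable {A} {e : J → Q × (α × (Fin d → ℕ)) × Q} {m : ℕ} {F : Finset ((Fin d → ℤ) × ℤ)}

/-- The run that corresponds to a sequence of transitions. -/
def toRun (e : J → Q × (α × (Fin d → ℕ)) × Q) (l : List J) : List ((α × (Fin d → ℕ)) × Q) :=
  l.map fun i => (e i).2

/-- Counters hold natural numbers, so every coefficient is split into its positive and negative
part, and the value of a linear form is the difference within a pair. -/
theorem weights_sub (t : F) (l : List J) :
    ((A.comparisonAutomaton e m F).weights l (t, true) : ℤ) -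
      (A.comparisonAutomaton e m F).weights l (t, false) =
      ∑ x, t.1.1 x * ((((toRun e l).map fun s => s.1.2).sum x : ℕ) : ℤ) := by
  induction l with
  | nil => simp [ComparisonAutomaton.weights, toRun]
  | cons i l ih =>
    simp only [ComparisonAutomaton.weights, toRun, List.map_cons, List.sum_cons, Pi.add_apply,
      Nat.cast_add, mul_add, Finset.sum_add_distrib] at ih ⊢
    rw [← ih]
    have h : ∑ x, t.1.1 x * ((e i).2.1.2 x : ℤ) = ∑ x, ((t.1.1 x).toNat : ℤ) * (e i).2.1.2 x -
        ∑ x, ((-t.1.1 x).toNat : ℤ) * (e i).2.1.2 x := by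
      rw [← Finset.sum_sub_distrib]
      refine Finset.sum_congr rfl fun x _ => ?_
      rw [← sub_mul, Int.toNat_sub_toNat_neg]
    rw [h]
    simp only [comparisonAutomaton]
    push_cast
    ring

theorem residue_sum (l : List J) (x : Fin d) :
    (l.map (A.comparisonAutomaton e m F).residue).sum x =
      ((((toRun e l).map fun s => s.1.2).sum x : ℕ) : ZMod m) := by
  induction l with
  | nil => simp [toRun]
  | cons i l ih =>
    simp only [toRun, List.map_cons, List.sum_cons, Pi.add_apply, Nat.cast_add] at ih ⊢
    rw [ih]
    rfl

/-- The predicate `good` asks only for some member of the constraint with the same residues and the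
same truth values of the inequalities; by `hF` the vector of the run is then itself in the
constraint. -/
theorem accepts_comparisonAutomaton_iff
    (hF : ∀ v v', (∀ t ∈ F, 0 ≤ t.2 + ∑ x, t.1 x * (v x : ℤ) ↔ 0 ≤ t.2 + ∑ x, t.1 x * (v' x : ℤ)) →
      (∀ x, v x ≡ v' x [MOD m]) → v ∈ A.constraint → v' ∈ A.constraint) (l : List J) :
    (A.comparisonAutomaton e m F).Accepts l ↔ (A.comparisonAutomaton e m F).Path none l ∧
      ((toRun e l).map fun s => s.1.2).sum ∈ A.constraint := by
  refine and_congr_right fun _ => ?_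
  have h : ∀ t : F, ComparisonAutomaton.comparison (fun c =>
      (A.comparisonAutomaton e m F).weight none c + (A.comparisonAutomaton e m F).weights l c) t
      = true ↔ 0 ≤ t.1.2 + ∑ x, t.1.1 x * ((((toRun e l).map fun s => s.1.2).sum x : ℕ) : ℤ) := by
    intro t
    rw [ComparisonAutomaton.comparison, decide_eq_true_eq, ← weights_sub (A := A) (m := m) t l]
    simp only [comparisonAutomaton]
    omega
  constructor
  · rintro ⟨v, hv, h1, h2⟩
    refine hF v _ (fun t ht => ?_) (fun x => ?_) hv
    · rw [← h2 ⟨t, ht⟩, h ⟨t, ht⟩]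
    · rw [← ZMod.natCast_eq_natCast_iff, h1, residue_sum]
  · intro hv
    exact ⟨_, hv, fun x => (residue_sum l x).symm, h⟩

theorem isRun_toRun (he : ∀ i, e i ∈ A.trans) {j : Option J} {l : List J}
    (h : (A.comparisonAutomaton e m F).Path j l) :
    ∃ q ∈ A.final, A.IsRun ((A.comparisonAutomaton e m F).target j) (toRun e l) q := by
  induction l generalizing j with
  | nil => exact ⟨_, h, .nil _⟩
  | cons i l ih =>
    obtain ⟨q, hq, h1⟩ := ih h.2
    refine ⟨q, hq, .cons ?_ h1⟩
    rw [← h.1]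
    exact he i

theorem exists_path (he : Set.range e = A.trans) {j : Option J} {p q : Q}
    {π : List ((α × (Fin d → ℕ)) × Q)} (h : A.IsRun p π q) (hq : q ∈ A.final)
    (hp : (A.comparisonAutomaton e m F).target j = p) :
    ∃ l, (A.comparisonAutomaton e m F).Path j l ∧ toRun e l = π := by
  induction h generalizing j with
  | nil p => exact ⟨[], by rw [← hp] at hq; exact hq, rfl⟩
  | @cons p q r x π ht h ih =>
    rw [← he] at ht
    obtain ⟨i, hi⟩ := ht
    obtain ⟨l, h1, h2⟩ := ih hq (j := some i) (by simp [comparisonAutomaton, hi])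
    refine ⟨i :: l, ⟨?_, h1⟩, ?_⟩
    · rw [hp]
      simp [comparisonAutomaton, hi]
    · simp only [toRun, List.map_cons, hi] at h2 ⊢
      rw [h2]

/-- A run omits the sources of its transitions, but each source is the target of the transition
before. -/
theorem toRun_injective (he : Function.Injective e) {j j' : Option J} {l l' : List J}
    (h : (A.comparisonAutomaton e m F).Path j l) (h' : (A.comparisonAutomaton e m F).Path j' l')
    (hj : (A.comparisonAutomaton e m F).target j = (A.comparisonAutomaton e m F).target j')
    (hl : toRun e l = toRun e l') : l = l' := by
  induction l generalizing j j' l' with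
  | nil => exact (List.map_eq_nil_iff.1 hl.symm).symm
  | cons i l ih =>
    rcases l' with _ | ⟨i', l'⟩
    · cases hl
    · simp only [toRun, List.map_cons, List.cons.injEq] at hl
      have h1 : (e i).1 = (e i').1 := h.1.trans (hj.trans h'.1.symm)
      obtain rfl : i = i' := he (Prod.ext h1 hl.1)
      rw [ih h.2 h'.2 rfl hl.2]

end ParikhAutomaton

theorem IsWeaklyUnambiguousPALanguage.isUnambiguousRBCMLanguage {α : Type*} {L : Language α}
    (h : IsWeaklyUnambiguousPALanguage L) : IsUnambiguousRBCMLanguage L := by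
  obtain ⟨Q, _, d, -, A, hA, rfl⟩ := h
  obtain ⟨m, hm, F, hF⟩ := A.semilinear.isTestable
  -- A positive modulus makes `ZMod m` finite, so the residues fit into the finite control.
  have := NeZero.of_pos hm
  have := A.finite_trans.to_subtype
  obtain ⟨N, ⟨e'⟩⟩ := Finite.exists_equiv_fin A.trans
  set e : Fin N → Q × (α × (Fin d → ℕ)) × Q := fun i => e'.symm i with he
  have he1 : Function.Injective e := Subtype.val_injective.comp e'.symm.injective
  have he2 : Set.range e = A.trans := by
    rw [he, show (fun i => (e'.symm i : Q × (α × (Fin d → ℕ)) × Q)) = Subtype.val ∘ e'.symm from rfl,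
      Set.range_comp, e'.symm.range_eq_univ, Set.image_univ, Subtype.range_coe]
  have hacc := fun l => ParikhAutomaton.accepts_comparisonAutomaton_iff (e := e) hF l
  have hrun : ∀ l, (A.comparisonAutomaton e m F).Accepts l →
      A.IsAcceptingRun (l.map (A.comparisonAutomaton e m F).letter) (ParikhAutomaton.toRun e l) := by
    intro l hl
    rw [hacc] at hl
    refine ⟨ParikhAutomaton.isRun_toRun (fun i => ?_) hl.1, ?_, hl.2⟩
    · rw [← he2]
      exact ⟨i, rfl⟩
    · rw [ParikhAutomaton.toRun, List.map_map]
      rfl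
  have key := (A.comparisonAutomaton e m F).isUnambiguousRBCMLanguage fun l l' h h' hl =>
    ParikhAutomaton.toRun_injective he1 h.1 h'.1 rfl (hA _ _ _ (hrun l h) (hl ▸ hrun l' h'))
  refine (congrArg IsUnambiguousRBCMLanguage (Set.ext fun w => ?_)).mpr key
  constructor
  · rintro ⟨π, ⟨q, hq, h1⟩, h2, h3⟩
    obtain ⟨l, h4, rfl⟩ := ParikhAutomaton.exists_path (m := m) (F := F) he2 h1 hq (j := none) rfl
    refine ⟨l, (hacc l).2 ⟨h4, h3⟩, ?_⟩
    rw [← h2, ParikhAutomaton.toRun, List.map_map]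
    rfl
  · rintro ⟨l, hl, rfl⟩
    exact ⟨_, hrun l hl⟩

theorem mainTheorem3 {α : Type*} [Finite α] (L : Language α) :
    IsUnambiguousRBCMLanguage L ↔ IsWeaklyUnambiguousPALanguage L :=
  ⟨fun h => h.isWeaklyUnambiguousPALanguage, fun h => h.isUnambiguousRBCMLanguage⟩
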